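/- Let $U\subseteq\mathbb R^m$ be open, $f:U\to\mathbb R^m$ (real) analytic, $T>0$, $y_0\in U$, and let $y:[t_0,t_0+T]\to U$ be the solution of the initial value problem $$y'(t)=f(y(t)),\quad t\in[t_0,t_0+T],\qquad y(t_0)=y_0 .$$ Let $\hat P_0,\hat P_1,\dots$ be the shifted Legendre polynomials on $[0,1]$, scaled to be orthonormal: $\deg\hat P_j=j$ and $\int_0^1\hat P_i\hat P_j\,dx=\delta_{ij}$. Fix an integer $r\ge1$. For a stepsize $h=T/N$ with $N\ge 1$ an integer, put $t_i=t_0+ih$, $i=0,\dots,N$. A *truncated Fourier approximation* with stepsize $h$ is a continuous function $\omega:[t_0,t_0+T]\to U$ with $\omega(t_0)=y_0$ which on every $[t_{i-1},t_i]$, $i=1,\dots,N$, satisfies (with one-sided derivatives at the end points) $$\omega'(t_{i-1}+ch)=\sum_{j=0}^{r-1}\hat P_j(c)\int_0^1\hat P_j(\tau)\,f(\omega(t_{i-1}+\tau h))\,d\tau,\qquad c\in[0,1].$$ Then there is a constant $C$, depending only on $f,y,T,r$, such that for every compact set $K\subseteq U$ whose interior contains $y([t_0,t_0+T])$ there is $h_0>0$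 with the following property: for every $h=T/N\le h_0$ there is exactly one truncated Fourier approximation $\omega$ with stepsize $h$ and values in $K$; it is a continuous function that on each $[t_{i-1},t_i]$ is a polynomial of degree at most $r$, and $$\|\omega(t_i)-y(t_i)\|\le C\,h^{2r},\qquad i=0,1,\dots,N .$$ -/

import Mathlib

open Set Polynomial

noncomputable section

namespace TruncatedFourier

/-- The shifted Legendre polynomial of degree `j` on `[0,1]`, scaled to be orthonormal in
`L²(0,1)`, with positive leading coefficient (Mathlib's `shiftedLegendre j` has leading
coefficient of sign `(-1)^j`, takes the value `1` at `0` and has squared norm `1 / (2j+1)`). -/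
def legendre (j : ℕ) (x : ℝ) : ℝ :=
  Real.sqrt (2 * j + 1) * (-1) ^ j * aeval x (shiftedLegendre j)

/-- The `j`-th Fourier coefficient `∫₀¹ P̂_j(τ) f(ω(s + τ h)) dτ` of `c ↦ f (ω (s + c h))`. -/
def coeff {m : ℕ} (f : EuclideanSpace ℝ (Fin m) → EuclideanSpace ℝ (Fin m)) (s h : ℝ)
    (ω : ℝ → EuclideanSpace ℝ (Fin m)) (j : ℕ) : EuclideanSpace ℝ (Fin m) :=
  ∫ τ in (0 : ℝ)..1, legendre j τ • f (ω (s + τ * h))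

/-- The grid point `t_i = t₀ + i h`. -/
def grid (t₀ h : ℝ) (i : ℕ) : ℝ := t₀ + i * h

/-- `y` solves `y' = f(y)` on `[t₀, t₀ + T]` with `y(t₀) = y₀`, staying in the domain `U` of `f`. -/
structure IsSolution {m : ℕ} (f : EuclideanSpace ℝ (Fin m) → EuclideanSpace ℝ (Fin m))
    (U : Set (EuclideanSpace ℝ (Fin m))) (t₀ T : ℝ) (y₀ : EuclideanSpace ℝ (Fin m))
    (y : ℝ → EuclideanSpace ℝ (Fin m)) : Prop where
  init : y t₀ = y₀
  mem : ∀ t ∈ Icc t₀ (t₀ + T), y t ∈ U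
  deriv : ∀ t ∈ Icc t₀ (t₀ + T), HasDerivWithinAt y (f (y t)) (Icc t₀ (t₀ + T)) t

/-- `ω` solves the truncated problem step by step on the `N` intervals `[t_i, t_{i+1}]`,
`i < N`: `ω(t₀) = y₀` and `ω'(t_i + c h) = ∑_{j<r} P̂_j(c) ∫₀¹ P̂_j(τ) f(ω(t_i + τ h)) dτ`
for `c ∈ [0,1]` (derivatives at the ends of a step are one-sided, from inside the step). The value
`ω(t_i)` reached by one step is the initial value of the next. -/
structure IsTruncatedSolution {m : ℕ}
    (f : EuclideanSpace ℝ (Fin m) → EuclideanSpace ℝ (Fin m))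
    (r : ℕ) (t₀ h : ℝ) (N : ℕ) (y₀ : EuclideanSpace ℝ (Fin m))
    (ω : ℝ → EuclideanSpace ℝ (Fin m)) : Prop where
  init : ω t₀ = y₀
  deriv : ∀ i < N, ∀ c ∈ Icc (0 : ℝ) 1,
    HasDerivWithinAt ω
      (∑ j ∈ Finset.range r, legendre j c • coeff f (grid t₀ h i) h ω j)
      (Icc (grid t₀ h i) (grid t₀ h (i + 1))) (grid t₀ h i + c * h)

/-- `ω` is continuous on `[t₀, t_N]` and on each `[t_i, t_{i+1}]`, `i < N`, it agrees with a
polynomial of degree at most `r` (with coefficients in `ℝᵐ`). -/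
def IsContinuousPiecewisePolynomial {m : ℕ} (r : ℕ) (t₀ h : ℝ) (N : ℕ)
    (ω : ℝ → EuclideanSpace ℝ (Fin m)) : Prop :=
  ContinuousOn ω (Icc t₀ (grid t₀ h N)) ∧
    ∀ i < N, ∃ p : Fin m → ℝ[X], (∀ k, (p k).natDegree ≤ r) ∧
      ∀ t ∈ Icc (grid t₀ h i) (grid t₀ h (i + 1)), ∀ k, ω t k = (p k).eval t

end TruncatedFourier

end

open Set Polynomial

noncomputable section

namespace TruncatedFourier

/-! The right-hand side of the truncated problem is `P f(ω)`, where `P` (`proj`) is the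
`L²(0,1)`-projection onto polynomials of degree less than `r` in the rescaled variable `c`. Replace
`f` by a globally Lipschitz `g` that agrees with it on `K`. Then one step is a contraction for the
`r` Fourier coefficients (`exists_step`), and `exists_stability_constant` bounds the effect of a
defect in the equation. With zero defect this is uniqueness. With `v = y` the defect is `g(y) - P
g(y) = O(h^r)`, so `ω - y = O(h^r)` on the whole interval. For small `h` this keeps `ω` inside `K`,
where it solves the problem for `f` itself.

The order `2r` at the grid points comes from orthogonality. On a step, `ε = ω - y` satisfies `ε' = h
(A ε + q - R)` with `A = f'(y)`, `q` the quadratic Taylor remainder, of size `O(h^(2r))`, and `R =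
f(ω) - P f(ω)`, of size `O(h^r)` and orthogonal to all polynomials of degree less than `r`.
Integrated over the step, `R` drops out, and it remains to bound `∫ A ε` by `O(‖ε 0‖ + h^(2r))`.
This is done without a resolvent: integrating `∫ (1-c)^k G ε` by parts and inserting the equation
for `ε` gains a factor `h` and raises `k` by one, while the `R` term stays small because a smooth
`G` is nearly polynomial (`exists_norm_integral_smul_clm_le`). After `r` rounds the crude bound `ε =
O(h^r)` has become `O(h^(2r))` (`exists_norm_integral_one_sub_pow_smul_clm_le`). A discrete Gronwall
argument sums the steps. -/

/-! ### Orthonormality and completeness of the Legendre polynomials. -/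

/-- Integration by parts `n` times. The hypotheses kill exactly the boundary terms that arise, so at
each endpoint the zeros may come from either factor. -/
theorem integral_iterate_derivative_mul (n : ℕ) : ∀ u v : ℝ[X],
    (∀ k < n, (derivative^[k] u * derivative^[n - 1 - k] v).eval 0 = 0) →
    (∀ k < n, (derivative^[k] u * derivative^[n - 1 - k] v).eval 1 = 0) →
    ∫ x in (0 : ℝ)..1, (derivative^[n] u * v).eval x =
      (-1) ^ n * ∫ x in (0 : ℝ)..1, (u * derivative^[n] v).eval x := by
  induction n with
  | zero => intro u v _ _; simp
  | succ n ih =>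
    intro u v h0 h1
    have hparts : ∫ x in (0 : ℝ)..1, (derivative (derivative^[n] u) * v).eval x =
        -∫ x in (0 : ℝ)..1, (derivative^[n] u * derivative v).eval x := by
      have hF := intervalIntegral.integral_eq_sub_of_hasDerivAt (a := 0) (b := 1)
        (fun x _ => (derivative^[n] u * v).hasDerivAt x)
        ((derivative (derivative^[n] u * v)).continuous.intervalIntegrable _ _)
      have e0 := h0 n (by omega)
      have e1 := h1 n (by omega)
      simp only [Nat.add_sub_cancel, Nat.sub_self, Function.iterate_zero, id] at e0 e1
      rw [e0, e1, derivative_mul] at hF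
      simp only [eval_add] at hF
      rw [intervalIntegral.integral_add (Polynomial.continuous _ |>.intervalIntegrable _ _)
        (Polynomial.continuous _ |>.intervalIntegrable _ _)] at hF
      linarith
    rw [Function.iterate_succ_apply', hparts, ih u (derivative v)]
    · rw [← Function.iterate_succ_apply, pow_succ]; ring
    all_goals
      intro k hk
      rw [← Function.iterate_succ_apply]
      first
        | simpa [show n - 1 - k + 1 = n - k by omega] using h0 k (by omega)
        | simpa [show n - 1 - k + 1 = n - k by omega] using h1 k (by omega)

theorem eval_iterate_derivative_eq_zero {p : ℝ[X]} {a : ℝ} {n k : ℕ} (h : (X - C a) ^ n ∣ p)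
    (hk : k < n) : (derivative^[k] p).eval a = 0 := by
  have h1 := pow_sub_dvd_iterate_derivative_of_pow_dvd k h
  have h2 : (X - C a) ∣ derivative^[k] p :=
    (dvd_pow_self _ (by omega : n - k ≠ 0)).trans h1
  exact dvd_iff_isRoot.mp h2

theorem sub_one_pow_dvd (n : ℕ) : (X - C (1 : ℝ)) ^ n ∣ ((1 : ℝ[X]) - X) ^ n :=
  pow_dvd_pow_of_dvd ⟨-1, by simp⟩ n

/-- A Beta integral. `X ^ n` is, up to a constant, the `n`-th derivative of `X ^ (2 * n)`; moving
these derivatives onto `(1 - X) ^ n` leaves a constant times `∫ x ^ (2n)`. -/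
theorem integral_X_pow_mul_one_sub_X_pow (n : ℕ) :
    ((2 * n).factorial : ℝ) * ∫ x in (0 : ℝ)..1, ((X : ℝ[X]) ^ n * (1 - X) ^ n).eval x =
      (n.factorial : ℝ) * n.factorial / (2 * n + 1) := by
  have h := integral_iterate_derivative_mul n (X ^ (2 * n)) ((1 - X : ℝ[X]) ^ n)
    (fun k hk => by
      rw [eval_mul, eval_iterate_derivative_eq_zero (n := 2 * n) (by simp) (by omega), zero_mul])
    (fun k hk => by
      rw [eval_mul, eval_iterate_derivative_eq_zero (n := n) (p := (1 - X) ^ n)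
        (sub_one_pow_dvd n) (by omega), mul_zero])
  have hd : derivative^[n] ((1 - X : ℝ[X]) ^ n) = C ((-1) ^ n * (n.factorial : ℝ)) := by
    have := iterate_derivative_comp_one_sub_X (X ^ n : ℝ[X]) n
    simp only [pow_comp, X_comp] at this
    rw [this, iterate_derivative_X_pow_eq_smul]
    simp [Nat.descFactorial_self, smul_eq_C_mul, mul_comm]
  have hfac : (n.factorial : ℝ) * (2 * n).descFactorial n = (2 * n).factorial := by
    have := Nat.factorial_mul_descFactorial (show n ≤ 2 * n by omega)
    rw [show 2 * n - n = n by omega] at this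
    exact_mod_cast this
  rw [hd, iterate_derivative_X_pow_eq_smul, show 2 * n - n = n by omega] at h
  simp only [smul_mul_assoc, eval_smul, eval_mul, eval_C, eval_pow, eval_X,
    intervalIntegral.integral_const_mul, intervalIntegral.integral_mul_const,
    eval_sub, eval_one, smul_eq_mul] at h ⊢
  rw [← hfac, mul_assoc, h, integral_pow]
  have : ((-1 : ℝ) ^ n) * (-1) ^ n = 1 := by rw [← mul_pow]; simp
  push_cast
  linear_combination ((n.factorial : ℝ) * n.factorial / (2 * n + 1)) * this

theorem X_pow_dvd_rodrigues (n : ℕ) : (X - C (0 : ℝ)) ^ n ∣ (X : ℝ[X]) ^ n * (1 - X) ^ n := by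
  simp

/-- The polynomial underlying `legendre j`. -/
def legendrePoly (j : ℕ) : ℝ[X] :=
  C (Real.sqrt (2 * j + 1) * (-1) ^ j) * (shiftedLegendre j).map (Int.castRingHom ℝ)

theorem eval_legendrePoly (j : ℕ) (x : ℝ) : (legendrePoly j).eval x = legendre j x := by
  simp [legendrePoly, legendre, aeval_def, eval_map]

theorem coeff_legendrePoly_self (j : ℕ) :
    (legendrePoly j).coeff j = Real.sqrt (2 * j + 1) * (2 * j).choose j := by
  have : ((-1 : ℝ) ^ j) * (-1) ^ j = 1 := by rw [← mul_pow]; simp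
  simp only [legendrePoly, coeff_C_mul, coeff_map, coeff_shiftedLegendre]
  simp only [Nat.choose_self, ← two_mul]
  push_cast
  simp only [Int.coe_castRingHom]
  push_cast
  linear_combination (Real.sqrt (2 * j + 1) * (2 * j).choose j) * this

theorem natDegree_legendrePoly_le (j : ℕ) : (legendrePoly j).natDegree ≤ j := by
  refine (natDegree_C_mul_le _ _).trans (natDegree_map_le.trans ?_)
  simp

/-- Rodrigues' formula. -/
theorem factorial_mul_legendrePoly (j : ℕ) :
    C (j.factorial : ℝ) * legendrePoly j =
      C (Real.sqrt (2 * j + 1) * (-1) ^ j) * derivative^[j] (X ^ j * (1 - X) ^ j) := by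
  have h := congrArg (Polynomial.map (Int.castRingHom ℝ)) (factorial_mul_shiftedLegendre_eq j)
  rw [← Polynomial.iterate_derivative_map] at h
  simp only [Polynomial.map_mul, Polynomial.map_natCast, Polynomial.map_pow, Polynomial.map_sub,
    Polynomial.map_one, map_X] at h
  rw [← h, legendrePoly, C_eq_natCast]
  ring

/-- Rodrigues' formula and `j` integrations by parts; the two signs `(-1) ^ j` cancel. Orthogonality
to lower degree is then immediate, and the norm reduces to the Beta integral because the `j`-th
derivative of `legendrePoly j` is constant. -/
theorem integral_legendrePoly_mul (j : ℕ) (q : ℝ[X]) :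
    (j.factorial : ℝ) * ∫ x in (0 : ℝ)..1, (legendrePoly j * q).eval x =
      Real.sqrt (2 * j + 1) *
        ∫ x in (0 : ℝ)..1, ((X : ℝ[X]) ^ j * (1 - X) ^ j * derivative^[j] q).eval x := by
  have h := integral_iterate_derivative_mul j (X ^ j * (1 - X) ^ j) q
    (fun k hk => by
      rw [eval_mul, eval_iterate_derivative_eq_zero (n := j) (X_pow_dvd_rodrigues j) hk, zero_mul])
    (fun k hk => by
      rw [eval_mul, eval_iterate_derivative_eq_zero (n := j)
        (Dvd.dvd.mul_left (sub_one_pow_dvd j) _) hk, zero_mul])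
  have h2 : ∀ x : ℝ, (j.factorial : ℝ) * (legendrePoly j * q).eval x =
      Real.sqrt (2 * j + 1) * (-1) ^ j *
        (derivative^[j] ((X : ℝ[X]) ^ j * (1 - X) ^ j) * q).eval x := by
    intro x
    have := congrArg (eval x) (factorial_mul_legendrePoly j)
    simp only [eval_mul, eval_C] at this ⊢
    linear_combination (q.eval x) * this
  rw [← intervalIntegral.integral_const_mul]
  simp only [h2]
  rw [intervalIntegral.integral_const_mul, h]
  have : ((-1 : ℝ) ^ j) * (-1) ^ j = 1 := by rw [← mul_pow]; simp
  linear_combination (Real.sqrt (2 * j + 1) *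
        ∫ x in (0 : ℝ)..1, ((X : ℝ[X]) ^ j * (1 - X) ^ j * derivative^[j] q).eval x) * this

theorem integral_legendrePoly_mul_of_lt {i j : ℕ} (h : i < j) :
    ∫ x in (0 : ℝ)..1, (legendrePoly j * legendrePoly i).eval x = 0 := by
  have h1 := integral_legendrePoly_mul j (legendrePoly i)
  rw [iterate_derivative_eq_zero ((natDegree_legendrePoly_le i).trans_lt h)] at h1
  have : (j.factorial : ℝ) ≠ 0 := by positivity
  simpa [this] using h1

theorem integral_legendrePoly_sq (j : ℕ) :
    ∫ x in (0 : ℝ)..1, (legendrePoly j * legendrePoly j).eval x = 1 := by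
  have h1 := integral_legendrePoly_mul j (legendrePoly j)
  have hd : derivative^[j] (legendrePoly j) =
      C ((j.factorial : ℝ) * (Real.sqrt (2 * j + 1) * (2 * j).choose j)) := by
    have hdeg : (derivative^[j] (legendrePoly j)).natDegree = 0 := by
      have := natDegree_iterate_derivative (legendrePoly j) j
      have := natDegree_legendrePoly_le j
      omega
    rw [eq_C_of_natDegree_eq_zero hdeg, coeff_iterate_derivative, zero_add,
      coeff_legendrePoly_self, Nat.descFactorial_self, nsmul_eq_mul]
  rw [hd] at h1
  have hev : ∀ (x a : ℝ) (u : ℝ[X]), (u * C a).eval x = u.eval x * a := fun x a u => by simp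
  simp only [hev] at h1
  have hw := integral_X_pow_mul_one_sub_X_pow j
  rw [intervalIntegral.integral_mul_const] at h1
  have hs : Real.sqrt (2 * j + 1) * Real.sqrt (2 * j + 1) = 2 * j + 1 :=
    Real.mul_self_sqrt (by positivity)
  have hch : ((2 * j).choose j : ℝ) * j.factorial * j.factorial = (2 * j).factorial := by
    have := Nat.choose_mul_factorial_mul_factorial (show j ≤ 2 * j by omega)
    rw [show 2 * j - j = j by omega] at this
    exact_mod_cast this
  have hf : (j.factorial : ℝ) ≠ 0 := by positivity
  have h2j : (2 * j + 1 : ℝ) ≠ 0 := by positivity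
  rw [← hch] at hw
  generalize hW : (∫ x in (0 : ℝ)..1, ((X : ℝ[X]) ^ j * (1 - X) ^ j).eval x) = W at hw h1
  rw [eq_div_iff h2j] at hw
  have hw' : ((2 * j).choose j : ℝ) * W * (2 * j + 1) = 1 := by
    have : (j.factorial : ℝ) * j.factorial ≠ 0 := by positivity
    apply mul_left_cancel₀ this
    linear_combination hw
  apply mul_left_cancel₀ hf
  rw [h1]
  linear_combination (j.factorial : ℝ) * hw' + (j.factorial : ℝ) * ((2 * j).choose j : ℝ) * W * hs

theorem integral_legendre_mul_legendre (i j : ℕ) :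
    ∫ x in (0 : ℝ)..1, legendre i x * legendre j x = if i = j then 1 else 0 := by
  have e : ∀ i j : ℕ, ∫ x in (0 : ℝ)..1, legendre i x * legendre j x =
      ∫ x in (0 : ℝ)..1, (legendrePoly i * legendrePoly j).eval x := by
    intro i j; simp [eval_legendrePoly]
  rcases lt_trichotomy i j with h | h | h
  · rw [if_neg h.ne, e, mul_comm, integral_legendrePoly_mul_of_lt h]
  · subst h; rw [if_pos rfl, e, integral_legendrePoly_sq]
  · rw [if_neg h.ne', e, integral_legendrePoly_mul_of_lt h]

theorem continuous_legendre (j : ℕ) : Continuous (legendre j) := by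
  have : legendre j = fun x => (legendrePoly j).eval x := by
    funext x; rw [eval_legendrePoly]
  rw [this]; exact Polynomial.continuous _

/-- Triangularity: a multiple of `legendrePoly r`, whose leading coefficient is nonzero, removes the
top coefficient. -/
theorem exists_eq_sum_legendrePoly (r : ℕ) : ∀ p : ℝ[X], p.degree < r →
    ∃ a : ℕ → ℝ, p = ∑ j ∈ Finset.range r, C (a j) * legendrePoly j := by
  induction r with
  | zero =>
    intro p hp
    refine ⟨0, ?_⟩
    have : p = 0 := by
      rw [← degree_eq_bot]
      simpa [Nat.WithBot.lt_zero_iff] using hp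
    simp [this]
  | succ r ih =>
    intro p hp
    have hlead : (legendrePoly r).coeff r ≠ 0 := by
      rw [coeff_legendrePoly_self]
      have := Nat.choose_pos (show r ≤ 2 * r by omega)
      positivity
    set b := p.coeff r / (legendrePoly r).coeff r with hb
    obtain ⟨a, ha⟩ := ih (p - C b * legendrePoly r) (by
      rw [degree_lt_iff_coeff_zero]
      intro k hk
      rcases hk.eq_or_lt with rfl | hk
      · simp [hb, hlead]
      · rw [coeff_sub, coeff_C_mul,
          coeff_eq_zero_of_natDegree_lt ((natDegree_legendrePoly_le r).trans_lt hk),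
          (degree_lt_iff_coeff_zero _ _).mp hp k (by omega)]
        simp)
    refine ⟨fun j => if j = r then b else a j, ?_⟩
    simp only [Finset.sum_range_succ, if_true]
    rw [Finset.sum_congr rfl (g := fun j => C (a j) * legendrePoly j)]
    · rw [← ha]; ring
    · intro j hj; rw [if_neg (Finset.mem_range.mp hj).ne]

theorem eval_eq_sum_legendre {r : ℕ} {p : ℝ[X]} (hp : p.degree < r) (c : ℝ) :
    ∑ j ∈ Finset.range r, legendre j c * ∫ x in (0 : ℝ)..1, legendre j x * p.eval x =
      p.eval c := by
  obtain ⟨a, rfl⟩ := exists_eq_sum_legendrePoly r p hp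
  have h : ∀ j ∈ Finset.range r, ∫ x in (0 : ℝ)..1, legendre j x *
      (∑ j ∈ Finset.range r, C (a j) * legendrePoly j).eval x = a j := by
    intro j hj
    simp only [eval_finsetSum, eval_mul, eval_C, eval_legendrePoly, Finset.mul_sum]
    rw [intervalIntegral.integral_finsetSum]
    · rw [Finset.sum_eq_single_of_mem j hj]
      · simp only [mul_left_comm _ (a j), intervalIntegral.integral_const_mul,
          integral_legendre_mul_legendre, if_true, mul_one]
      · intro i _ hij
        simp only [mul_left_comm _ (a i), intervalIntegral.integral_const_mul,
          integral_legendre_mul_legendre, if_neg hij.symm, mul_zero]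
    · intro i _
      exact ((continuous_legendre j).mul (continuous_const.mul
        (continuous_legendre i))).intervalIntegrable _ _
  rw [Finset.sum_congr rfl fun j hj => by rw [h j hj]]
  simp [eval_finsetSum, eval_legendrePoly, mul_comm]

/-! ### The projection onto polynomials of degree less than `r`. -/

section Projection

variable {E : Type*} [NormedAddCommGroup E] [NormedSpace ℝ E]

/-- The truncated Legendre expansion of `φ`, the `L²(0,1)`-projection to polynomials of degree
less than `r`. -/
def proj (r : ℕ) (φ : ℝ → E) (c : ℝ) : E :=
  ∑ j ∈ Finset.range r, legendre j c • ∫ τ in (0 : ℝ)..1, legendre j τ • φ τ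

theorem continuous_proj (r : ℕ) (φ : ℝ → E) : Continuous (proj r φ) :=
  continuous_finsetSum _ fun j _ => (continuous_legendre j).smul continuous_const

theorem intervalIntegrable_smul {φ : ℝ → E} (hφ : ContinuousOn φ (Icc 0 1)) {w : ℝ → ℝ}
    (hw : Continuous w) : IntervalIntegrable (fun τ => w τ • φ τ) MeasureTheory.volume 0 1 := by
  apply ContinuousOn.intervalIntegrable
  rw [uIcc_of_le zero_le_one]
  exact hw.continuousOn.smul hφ

theorem proj_sub {r : ℕ} {φ ψ : ℝ → E} (hφ : ContinuousOn φ (Icc 0 1))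
    (hψ : ContinuousOn ψ (Icc 0 1)) (c : ℝ) :
    proj r (fun τ => φ τ - ψ τ) c = proj r φ c - proj r ψ c := by
  simp only [proj, ← Finset.sum_sub_distrib, ← smul_sub (legendre _ c)]
  refine Finset.sum_congr rfl fun j _ => ?_
  simp only [smul_sub (legendre j _) (φ _)]
  rw [ intervalIntegral.integral_sub (intervalIntegrable_smul hφ (continuous_legendre j))
    (intervalIntegrable_smul hψ (continuous_legendre j))]

theorem exists_norm_legendre_le (r : ℕ) :
    ∃ b : ℝ, 0 ≤ b ∧ ∀ j < r, ∀ c ∈ Icc (0 : ℝ) 1, ‖legendre j c‖ ≤ b := by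
  have h : ∀ j, ∃ b, ∀ c ∈ Icc (0 : ℝ) 1, ‖legendre j c‖ ≤ b := fun j =>
    isCompact_Icc.exists_bound_of_continuousOn (continuous_legendre j).continuousOn
  choose b hb using h
  have hnn : ∀ j, 0 ≤ b j := fun j => (norm_nonneg _).trans (hb j 0 (by simp))
  exact ⟨∑ j ∈ Finset.range r, b j, Finset.sum_nonneg fun j _ => hnn j, fun j hj c hc =>
    (hb j c hc).trans (Finset.single_le_sum (fun j _ => hnn j) (Finset.mem_range.mpr hj))⟩

theorem norm_integral_legendre_smul_le {b M : ℝ} {j : ℕ} {φ : ℝ → E}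
    (hb : ∀ c ∈ Icc (0 : ℝ) 1, ‖legendre j c‖ ≤ b) (hb0 : 0 ≤ b)
    (hM : ∀ c ∈ Icc (0 : ℝ) 1, ‖φ c‖ ≤ M) :
    ‖∫ τ in (0 : ℝ)..1, legendre j τ • φ τ‖ ≤ b * M := by
  have := intervalIntegral.norm_integral_le_of_norm_le_const (a := (0 : ℝ)) (b := 1) (C := b * M)
    (f := fun τ => legendre j τ • φ τ) (fun τ hτ => by
      rw [uIoc_of_le zero_le_one] at hτ
      have hτ' := Ioc_subset_Icc_self hτ
      rw [norm_smul]
      exact mul_le_mul (hb τ hτ') (hM τ hτ') (norm_nonneg _) hb0)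
  simpa using this

/-- Boundedness in the sup norm, with a constant that depends on `r` alone and not on the step
length or the target space. -/
theorem exists_norm_proj_le (r : ℕ) : ∃ B : ℝ, 0 ≤ B ∧ ∀ {E : Type*} [NormedAddCommGroup E]
    [NormedSpace ℝ E] (φ : ℝ → E) (M : ℝ), (∀ c ∈ Icc (0 : ℝ) 1, ‖φ c‖ ≤ M) →
    ∀ c ∈ Icc (0 : ℝ) 1, ‖proj r φ c‖ ≤ B * M := by
  obtain ⟨b, hb0, hb⟩ := exists_norm_legendre_le r
  refine ⟨r * (b * b), by positivity, fun φ M hM c hc => ?_⟩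
  have : ∀ j ∈ Finset.range r, ‖legendre j c • ∫ τ in (0 : ℝ)..1, legendre j τ • φ τ‖ ≤
      b * (b * M) := by
    intro j hj
    have hj' := Finset.mem_range.mp hj
    rw [norm_smul]
    exact mul_le_mul (hb j hj' c hc) (norm_integral_legendre_smul_le (hb j hj') hb0 hM)
      (norm_nonneg _) hb0
  refine (norm_sum_le_of_le _ this).trans ?_
  simp only [Finset.sum_const, Finset.card_range, nsmul_eq_mul]
  apply le_of_eq; ring

theorem proj_sum_smul [CompleteSpace E] {r : ℕ} (n : ℕ) (p : ℕ → ℝ[X]) (a : ℕ → E)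
    (hp : ∀ k < n, (p k).degree < r) (c : ℝ) :
    proj r (fun τ => ∑ k ∈ Finset.range n, (p k).eval τ • a k) c =
      ∑ k ∈ Finset.range n, (p k).eval c • a k := by
  have h : ∀ j, ∫ τ in (0 : ℝ)..1, legendre j τ • ∑ k ∈ Finset.range n, (p k).eval τ • a k =
      ∑ k ∈ Finset.range n, (∫ τ in (0 : ℝ)..1, legendre j τ * (p k).eval τ) • a k := by
    intro j
    simp only [Finset.smul_sum, smul_smul]
    rw [intervalIntegral.integral_finsetSum]
    · simp only [intervalIntegral.integral_smul_const]
    · intro k _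
      exact (((continuous_legendre j).mul (p k).continuous).smul
        continuous_const).intervalIntegrable _ _
  simp only [proj, h]
  simp only [Finset.smul_sum, smul_smul]
  rw [Finset.sum_comm]
  refine Finset.sum_congr rfl fun k hk => ?_
  rw [← Finset.sum_smul, eval_eq_sum_legendre (hp k (Finset.mem_range.mp hk))]

/-- Expand `p` in the Legendre basis; both integrals become the same combination of Fourier
coefficients of `φ`. -/
theorem integral_smul_sub_proj [CompleteSpace E] {r : ℕ} {p : ℝ[X]} (hp : p.degree < r)
    {φ : ℝ → E} (hφ : ContinuousOn φ (Icc 0 1)) :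
    ∫ τ in (0 : ℝ)..1, p.eval τ • (φ τ - proj r φ τ) = 0 := by
  simp only [smul_sub]
  rw [intervalIntegral.integral_sub (intervalIntegrable_smul hφ p.continuous)
    (intervalIntegrable_smul (continuous_proj r φ).continuousOn p.continuous), sub_eq_zero]
  have h1 : ∀ τ, p.eval τ • φ τ = ∑ j ∈ Finset.range r,
      (∫ x in (0 : ℝ)..1, legendre j x * p.eval x) • legendre j τ • φ τ := by
    intro τ
    rw [← eval_eq_sum_legendre hp τ, Finset.sum_smul]
    refine Finset.sum_congr rfl fun j _ => ?_
    rw [smul_smul, mul_comm]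
  simp only [h1]
  rw [intervalIntegral.integral_finsetSum]
  swap
  · intro j _
    exact (intervalIntegrable_smul hφ (continuous_legendre j)).smul _
  simp only [proj, Finset.smul_sum, smul_smul]
  rw [intervalIntegral.integral_finsetSum]
  · refine Finset.sum_congr rfl fun j _ => ?_
    simp only [mul_smul _ _ (φ _)]
    rw [intervalIntegral.integral_smul, intervalIntegral.integral_smul_const]
    congr 1
    refine intervalIntegral.integral_congr fun x _ => ?_
    simp only [mul_comm]
  · intro j _
    exact ((p.continuous.mul (continuous_legendre j)).smul continuous_const).intervalIntegrable _ _

end Projection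

/-! ### Polynomial approximation on short intervals. -/

section Approximation

variable {F : Type*} [NormedAddCommGroup F] [NormedSpace ℝ F]

theorem add_mul_mem_Icc {a b s h c : ℝ} (hh : 0 ≤ h) (hs : a ≤ s) (hsb : s + h ≤ b)
    (hc : c ∈ Icc (0 : ℝ) 1) : s + c * h ∈ Icc a b :=
  ⟨by nlinarith [mul_nonneg hc.1 hh], by nlinarith [mul_nonneg (sub_nonneg.mpr hc.2) hh]⟩

theorem hasDerivWithinAt_comp_affine {a b s h c : ℝ} {G : ℝ → F} {G' : F} (hh : 0 ≤ h)
    (hs : a ≤ s) (hsb : s + h ≤ b) (hG : HasDerivWithinAt G G' (Icc a b) (s + c * h)) :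
    HasDerivWithinAt (fun c => G (s + c * h)) (h • G') (Icc 0 1) c := by
  have h1 : HasDerivWithinAt (fun c : ℝ => s + c * h) h (Icc 0 1) c := by
    simpa using (((hasDerivAt_id c).mul_const h).const_add s).hasDerivWithinAt
  exact hG.scomp c h1 fun c hc => add_mul_mem_Icc hh hs hsb hc

theorem continuousOn_comp_affine {F : Type*} [TopologicalSpace F] {a b s h : ℝ} {G : ℝ → F}
    (hh : 0 ≤ h) (hs : a ≤ s) (hsb : s + h ≤ b) (hG : ContinuousOn G (Icc a b)) :
    ContinuousOn (fun c => G (s + c * h)) (Icc 0 1) :=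
  hG.comp (by fun_prop) fun _ hc => add_mul_mem_Icc hh hs hsb hc

/-- A `C^r` function is, on intervals of length `h`, within `O(h^r)` of polynomials of degree
less than `r`, uniformly in the position of the interval. -/
theorem exists_approx_polynomial {a b : ℝ} (hab : a < b) (r : ℕ) : ∀ (G : ℝ → F),
    ContDiffOn ℝ r G (Icc a b) → ∃ C : ℝ, 0 ≤ C ∧ ∀ s h : ℝ, 0 ≤ h → a ≤ s → s + h ≤ b →
      ∃ p : ℕ → F, ∀ c ∈ Icc (0 : ℝ) 1,
        ‖G (s + c * h) - ∑ k ∈ Finset.range r, c ^ k • p k‖ ≤ C * h ^ r := by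
  induction r with
  | zero =>
    intro G hG
    obtain ⟨C, hC⟩ := isCompact_Icc.exists_bound_of_continuousOn hG.continuousOn
    refine ⟨C, (norm_nonneg _).trans (hC a ⟨le_rfl, hab.le⟩), fun s h hh hs hsb =>
      ⟨0, fun c hc => ?_⟩⟩
    simpa using hC _ (add_mul_mem_Icc hh hs hsb hc)
  | succ r ih =>
    intro G hG
    have hud := uniqueDiffOn_Icc hab
    push_cast at hG
    rw [contDiffOn_succ_iff_derivWithin hud] at hG
    obtain ⟨C, hC0, hC⟩ := ih _ hG.2.2
    refine ⟨C, hC0, fun s h hh hs hsb => ?_⟩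
    obtain ⟨p, hp⟩ := hC s h hh hs hsb
    -- The approximant of `G` is the antiderivative of the one for its derivative: constant term `G
    -- s`, with `h` coming from the rescaling. The mean value inequality then supplies the extra
    -- power of `h`.
    refine ⟨fun k => match k with
      | 0 => G s
      | k + 1 => (h / (k + 1)) • p k, ?_⟩
    set D : ℝ → F := fun c => G (s + c * h) -
      (∑ k ∈ Finset.range r, c ^ (k + 1) • (h / ((k : ℝ) + 1)) • p k + G s) with hD
    have hderiv : ∀ c ∈ Icc (0 : ℝ) 1, HasDerivWithinAt D
        (h • (derivWithin G (Icc a b) (s + c * h) - ∑ k ∈ Finset.range r, c ^ k • p k))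
        (Icc 0 1) c := by
      intro c hc
      have h1 := hasDerivWithinAt_comp_affine hh hs hsb
        ((hG.1 _ (add_mul_mem_Icc hh hs hsb hc)).hasDerivWithinAt)
      have h2 : HasDerivAt (fun c : ℝ => ∑ k ∈ Finset.range r,
          c ^ (k + 1) • (h / ((k : ℝ) + 1)) • p k + G s)
          (h • ∑ k ∈ Finset.range r, c ^ k • p k) c := by
        rw [Finset.smul_sum]
        refine (HasDerivAt.fun_sum fun k _ => ?_).add_const _
        have := (hasDerivAt_pow (k + 1) c).smul_const ((h / ((k : ℝ) + 1)) • p k)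
        refine this.congr_deriv ?_
        rw [smul_smul, smul_smul]
        congr 1
        push_cast
        have : (k : ℝ) + 1 ≠ 0 := by positivity
        field_simp
      rw [smul_sub]
      exact h1.sub h2.hasDerivWithinAt
    intro c hc
    have hmv := (convex_Icc (0 : ℝ) 1).norm_image_sub_le_of_norm_hasDerivWithin_le
      (C := C * h ^ (r + 1)) hderiv (fun x hx => by
        rw [norm_smul, Real.norm_of_nonneg hh, pow_succ]
        nlinarith [mul_le_mul_of_nonneg_left (hp x hx) hh]) ⟨le_rfl, zero_le_one⟩ hc
    have hD0 : D 0 = 0 := by simp [hD]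
    have hDc : D c = G (s + c * h) - ∑ k ∈ Finset.range (r + 1), c ^ k •
        (match k with
          | 0 => G s
          | k + 1 => (h / ((k : ℝ) + 1)) • p k) := by
      rw [Finset.sum_range_succ']
      simp [hD]
    rw [hD0, sub_zero, hDc, sub_zero, Real.norm_of_nonneg hc.1] at hmv
    refine hmv.trans ?_
    have : 0 ≤ C * h ^ (r + 1) := by positivity
    nlinarith [hc.2]

/-- `proj` fixes polynomials of degree less than `r`, so its error is at most `1 + B` times that of
any such approximant. -/
theorem exists_norm_sub_proj_le [CompleteSpace F] {a b : ℝ} (hab : a < b) {r : ℕ} {G : ℝ → F}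
    (hG : ContDiffOn ℝ r G (Icc a b)) :
    ∃ C : ℝ, 0 ≤ C ∧ ∀ s h : ℝ, 0 ≤ h → a ≤ s → s + h ≤ b → ∀ c ∈ Icc (0 : ℝ) 1,
      ‖G (s + c * h) - proj r (fun τ => G (s + τ * h)) c‖ ≤ C * h ^ r := by
  obtain ⟨C, hC0, hC⟩ := exists_approx_polynomial hab r G hG
  obtain ⟨B, hB0, hB⟩ := exists_norm_proj_le r
  refine ⟨(1 + B) * C, by positivity, fun s h hh hs hsb c hc => ?_⟩
  obtain ⟨p, hp⟩ := hC s h hh hs hsb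
  have hrep := proj_sum_smul (r := r) r (fun k => X ^ k) p
    (fun k hk => by rw [degree_X_pow]; exact_mod_cast hk) c
  simp only [eval_pow, eval_X] at hrep
  have hsub := proj_sub (r := r) (continuousOn_comp_affine hh hs hsb hG.continuousOn)
    (ψ := fun τ => ∑ k ∈ Finset.range r, τ ^ k • p k) (by fun_prop) c
  have e : G (s + c * h) - proj r (fun τ => G (s + τ * h)) c =
      (G (s + c * h) - ∑ k ∈ Finset.range r, c ^ k • p k) -
        proj r (fun τ => G (s + τ * h) - ∑ k ∈ Finset.range r, τ ^ k • p k) c := by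
    rw [hsub, hrep]; abel
  rw [e]
  refine (norm_sub_le _ _).trans ?_
  have := hB _ _ hp c hc
  linarith [hp c hc]

/-- Approximate `G` by a polynomial of degree less than `l`, up to `O(h^l)`. Multiplied by `(1 - c)
^ k` it has degree less than `k + l ≤ r`, so its contribution vanishes by orthogonality of `R`,
leaving only the approximation error. -/
theorem exists_norm_integral_smul_clm_le {E : Type*} [NormedAddCommGroup E] [NormedSpace ℝ E]
    [CompleteSpace E] [CompleteSpace F] {a b : ℝ} (hab : a < b) {r k l : ℕ} (hkl : k + l ≤ r)
    {G : ℝ → E →L[ℝ] F} (hG : ContDiffOn ℝ l G (Icc a b)) :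
    ∃ C : ℝ, 0 ≤ C ∧ ∀ s h : ℝ, 0 ≤ h → a ≤ s → s + h ≤ b → ∀ (R : ℝ → E) (M : ℝ),
      ContinuousOn R (Icc 0 1) → (∀ c ∈ Icc (0 : ℝ) 1, ‖R c‖ ≤ M) →
      (∀ p : ℝ[X], p.degree < r → ∫ c in (0 : ℝ)..1, p.eval c • R c = 0) →
      ‖∫ c in (0 : ℝ)..1, (1 - c) ^ k • G (s + c * h) (R c)‖ ≤ C * h ^ l * M := by
  obtain ⟨C, hC0, hC⟩ := exists_approx_polynomial hab l G hG
  refine ⟨C, hC0, fun s h hh hs hsb R M hR hM horth => ?_⟩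
  obtain ⟨p, hp⟩ := hC s h hh hs hsb
  have hint : ∀ H : ℝ → E →L[ℝ] F, ContinuousOn H (Icc 0 1) →
      IntervalIntegrable (fun c => (1 - c) ^ k • H c (R c)) MeasureTheory.volume 0 1 :=
    fun H hH => intervalIntegrable_smul (hH.clm_apply hR) (by fun_prop)
  have hzero : ∫ c in (0 : ℝ)..1, (1 - c) ^ k •
      (∑ i ∈ Finset.range l, c ^ i • p i) (R c) = 0 := by
    have e : ∀ c : ℝ, (1 - c) ^ k • (∑ i ∈ Finset.range l, c ^ i • p i) (R c) =
        ∑ i ∈ Finset.range l, p i (((1 - X) ^ k * X ^ i : ℝ[X]).eval c • R c) := by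
      intro c
      simp only [_root_.sum_apply, _root_.smul_apply, Finset.smul_sum,
        smul_smul, map_smul, eval_mul, eval_pow, eval_sub, eval_one, eval_X]
    simp only [e]
    have hi : ∀ i, IntervalIntegrable (fun c => ((1 - X) ^ k * X ^ i : ℝ[X]).eval c • R c)
        MeasureTheory.volume 0 1 :=
      fun i => intervalIntegrable_smul hR (Polynomial.continuous _)
    rw [intervalIntegral.integral_finsetSum]
    · refine Finset.sum_eq_zero fun i hi' => ?_
      rw [ContinuousLinearMap.intervalIntegral_comp_comm _ (hi i), horth, map_zero]
      have hi'' := Finset.mem_range.mp hi'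
      refine lt_of_le_of_lt (b := ((k + i : ℕ) : WithBot ℕ)) ?_ (by norm_cast; omega)
      refine degree_le_of_natDegree_le ?_
      refine natDegree_mul_le.trans (Nat.add_le_add ?_ (by simp))
      refine natDegree_pow_le.trans ?_
      have : (1 - X : ℝ[X]).natDegree ≤ 1 := by
        refine (natDegree_sub_le _ _).trans (by simp)
      nlinarith
    · intro i _
      exact ⟨(p i).integrable_comp (hi i).1, (p i).integrable_comp (hi i).2⟩
  have e : ∫ c in (0 : ℝ)..1, (1 - c) ^ k • G (s + c * h) (R c) =
      ∫ c in (0 : ℝ)..1, (1 - c) ^ k •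
        (G (s + c * h) - ∑ i ∈ Finset.range l, c ^ i • p i) (R c) := by
    simp only [_root_.sub_apply, smul_sub]
    rw [intervalIntegral.integral_sub
      (hint _ (continuousOn_comp_affine hh hs hsb hG.continuousOn)) (hint _ (by fun_prop)), hzero,
      sub_zero]
  rw [e]
  have := intervalIntegral.norm_integral_le_of_norm_le_const (a := (0 : ℝ)) (b := 1)
    (C := C * h ^ l * M) (f := fun c => (1 - c) ^ k •
        (G (s + c * h) - ∑ i ∈ Finset.range l, c ^ i • p i) (R c)) (fun c hc => by
      rw [uIoc_of_le zero_le_one] at hc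
      have hc' := Ioc_subset_Icc_self hc
      have h1 : ‖(1 - c) ^ k‖ ≤ 1 := by
        rw [norm_pow]
        refine pow_le_one₀ (norm_nonneg _) ?_
        rw [Real.norm_of_nonneg (by linarith [hc'.2])]
        linarith [hc'.1]
      have h2 := ContinuousLinearMap.le_of_opNorm_le_of_le _ (hp c hc') (hM c hc')
      rw [norm_smul]
      nlinarith [norm_nonneg ((G (s + c * h) - ∑ i ∈ Finset.range l, c ^ i • p i) (R c))])
  simpa using this

end Approximation

/-! ### Gronwall's inequality and stability over one step. -/

section Stability

variable {E : Type*} [NormedAddCommGroup E] [NormedSpace ℝ E]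

theorem discrete_gronwall {a : ℕ → ℝ} {x d : ℝ} {N : ℕ} (hx : 0 ≤ x) (hd : 0 ≤ d) (h0 : a 0 ≤ 0)
    (h : ∀ i < N, a (i + 1) ≤ (1 + x) * a i + d) :
    ∀ i ≤ N, a i ≤ N * Real.exp (N * x) * d := by
  -- The factor `i` counts the defects accumulated so far, each amplified by at most `(1 + x) ^ i`.
  have key : ∀ i ≤ N, a i ≤ i * (1 + x) ^ i * d := by
    intro i
    induction i with
    | zero => intro _; simpa using h0
    | succ i ih =>
      intro hi
      have h1 := ih (by omega)
      have h2 := h i (by omega)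
      have h3 : (1 : ℝ) ≤ (1 + x) ^ (i + 1) := one_le_pow₀ (by linarith)
      push_cast
      calc a (i + 1) ≤ (1 + x) * (i * (1 + x) ^ i * d) + d := by
            refine h2.trans ?_
            gcongr
        _ ≤ (1 + x) * (i * (1 + x) ^ i * d) + (1 + x) ^ (i + 1) * d := by
            gcongr
            exact le_mul_of_one_le_left hd h3
        _ = _ := by ring
  intro i hi
  refine (key i hi).trans ?_
  have h1 : (1 + x) ^ i ≤ Real.exp (N * x) := by
    calc (1 + x) ^ i ≤ (1 + x) ^ N := pow_le_pow_right₀ (by linarith) hi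
      _ ≤ Real.exp x ^ N := by
          gcongr
          linarith [Real.add_one_le_exp x]
      _ = _ := by rw [← Real.exp_nat_mul]
  have h2 : (i : ℝ) ≤ N := by exact_mod_cast hi
  gcongr

/-- Let `M` be the maximum of `‖u - v‖` over the step and `x = h * (B * L)`. The mean value
inequality gives `M ≤ ‖u 0 - v 0‖ + x * M + h * η`, and `x ≤ 1 / 2` lets `x * M` be absorbed, since
`1 / (1 - x) ≤ 1 + 2 * x ≤ 2`. The factor `1 + O(h)` is what makes the bound iterable. -/
theorem step_stability {r : ℕ} {B L h η : ℝ} (hB0 : 0 ≤ B) (hL0 : 0 ≤ L)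
    (hB : ∀ (φ : ℝ → E) (M : ℝ), (∀ c ∈ Icc (0 : ℝ) 1, ‖φ c‖ ≤ M) →
      ∀ c ∈ Icc (0 : ℝ) 1, ‖proj r φ c‖ ≤ B * M)
    {g : E → E} (hgc : Continuous g) (hg : ∀ x y, ‖g x - g y‖ ≤ L * ‖x - y‖)
    (hh : 0 ≤ h) (hη : 0 ≤ η) (hsmall : h * (B * L) ≤ 1 / 2) {u v ρ : ℝ → E}
    (hu : ∀ c ∈ Icc (0 : ℝ) 1,
      HasDerivWithinAt u (h • proj r (fun τ => g (u τ)) c) (Icc 0 1) c)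
    (hv : ∀ c ∈ Icc (0 : ℝ) 1,
      HasDerivWithinAt v (h • (proj r (fun τ => g (v τ)) c + ρ c)) (Icc 0 1) c)
    (hρ : ∀ c ∈ Icc (0 : ℝ) 1, ‖ρ c‖ ≤ η) :
    ∀ c ∈ Icc (0 : ℝ) 1,
      ‖u c - v c‖ ≤ (1 + 2 * (h * (B * L))) * ‖u 0 - v 0‖ + 2 * (h * η) := by
  have huc : ContinuousOn u (Icc 0 1) := fun c hc => (hu c hc).continuousWithinAt
  have hvc : ContinuousOn v (Icc 0 1) := fun c hc => (hv c hc).continuousWithinAt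
  obtain ⟨c₀, hc₀, hmax⟩ := isCompact_Icc.exists_isMaxOn (nonempty_Icc.mpr zero_le_one)
    (huc.sub hvc).norm
  set M := ‖u c₀ - v c₀‖ with hM
  have hmax' : ∀ c ∈ Icc (0 : ℝ) 1, ‖u c - v c‖ ≤ M := fun c hc => hmax hc
  have hderiv : ∀ c ∈ Icc (0 : ℝ) 1, HasDerivWithinAt (fun c => u c - v c)
      (h • (proj r (fun τ => g (u τ) - g (v τ)) c - ρ c)) (Icc 0 1) c := by
    intro c hc
    refine ((hu c hc).sub (hv c hc)).congr_deriv ?_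
    rw [proj_sub (φ := fun τ => g (u τ)) (ψ := fun τ => g (v τ)) (hgc.comp_continuousOn huc)
      (hgc.comp_continuousOn hvc), ← smul_sub]
    congr 1
    abel
  have hbound : ∀ c ∈ Icc (0 : ℝ) 1,
      ‖h • (proj r (fun τ => g (u τ) - g (v τ)) c - ρ c)‖ ≤ h * (B * L) * M + h * η := by
    intro c hc
    rw [norm_smul, Real.norm_of_nonneg hh]
    have h1 := hB (fun τ => g (u τ) - g (v τ)) (L * M) (fun τ hτ =>
      (hg _ _).trans (mul_le_mul_of_nonneg_left (hmax' τ hτ) hL0)) c hc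
    have h2 := (norm_sub_le (proj r (fun τ => g (u τ) - g (v τ)) c) (ρ c)).trans
      (add_le_add h1 (hρ c hc))
    calc _ ≤ h * (B * (L * M) + η) := mul_le_mul_of_nonneg_left h2 hh
      _ = _ := by ring
  have hmv := (convex_Icc (0 : ℝ) 1).norm_image_sub_le_of_norm_hasDerivWithin_le hderiv hbound
    ⟨le_rfl, zero_le_one⟩ hc₀
  have hM0 : 0 ≤ M := norm_nonneg _
  set x := h * (B * L) with hx
  have hx0 : 0 ≤ x := by positivity
  have hhη : 0 ≤ h * η := by positivity
  have hMle : M ≤ ‖u 0 - v 0‖ + x * M + h * η := by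
    have h1 : M ≤ ‖u 0 - v 0‖ + ‖u c₀ - v c₀ - (u 0 - v 0)‖ := by
      have := norm_add_le (u 0 - v 0) (u c₀ - v c₀ - (u 0 - v 0))
      rwa [add_sub_cancel] at this
    have h2 : (x * M + h * η) * ‖c₀ - 0‖ ≤ x * M + h * η := by
      refine mul_le_of_le_one_right (by positivity) ?_
      rw [sub_zero, Real.norm_of_nonneg hc₀.1]
      exact hc₀.2
    linarith
  intro c hc
  refine (hmax' c hc).trans ?_
  have hA := norm_nonneg (u 0 - v 0)
  nlinarith [mul_nonneg (sub_nonneg.mpr hsmall) hM0, mul_nonneg hx0 hA, mul_nonneg hx0 hhη,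
    mul_nonneg hx0 (sub_nonneg.mpr hMle), mul_nonneg (mul_nonneg hx0 (sub_nonneg.mpr hsmall)) hM0]

end Stability

/-! ### Grid, regularity of truncated solutions, and global stability. -/

section Solutions

variable {m r N : ℕ} {f g : EuclideanSpace ℝ (Fin m) → EuclideanSpace ℝ (Fin m)} {t₀ h : ℝ}
  {y₀ : EuclideanSpace ℝ (Fin m)} {ω : ℝ → EuclideanSpace ℝ (Fin m)}

theorem grid_succ (t₀ h : ℝ) (i : ℕ) : grid t₀ h (i + 1) = grid t₀ h i + h := by
  simp only [grid]; push_cast; ring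

theorem grid_mono (hh : 0 ≤ h) : Monotone (grid t₀ h) := fun i j hij => by
  have : (i : ℝ) ≤ j := by exact_mod_cast hij
  simp only [grid]
  gcongr

theorem grid_zero (t₀ h : ℝ) : grid t₀ h 0 = t₀ := by simp [grid]

theorem le_grid (hh : 0 ≤ h) (i : ℕ) : t₀ ≤ grid t₀ h i := by
  simpa [grid_zero] using grid_mono (t₀ := t₀) hh (Nat.zero_le i)

theorem grid_add_mul_mem (hh : 0 ≤ h) {i : ℕ} (hi : i < N) {c : ℝ} (hc : c ∈ Icc (0 : ℝ) 1) :
    grid t₀ h i + c * h ∈ Icc t₀ (grid t₀ h N) :=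
  add_mul_mem_Icc hh (le_grid hh i) (by
    rw [← grid_succ]; exact grid_mono hh (Nat.succ_le_of_lt hi)) hc

theorem exists_grid_add_mul_eq (hh : 0 < h) {t : ℝ} : ∀ {N : ℕ}, 0 < N →
    t ∈ Icc t₀ (grid t₀ h N) → ∃ i < N, ∃ c ∈ Icc (0 : ℝ) 1, t = grid t₀ h i + c * h := by
  intro N
  induction N with
  | zero => intro h; exact absurd h (lt_irrefl _)
  | succ n ih =>
    intro _ ht
    rcases le_or_gt (grid t₀ h n) t with hn | hn
    · refine ⟨n, n.lt_succ_self, (t - grid t₀ h n) / h, ⟨by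
        have := sub_nonneg.mpr hn; positivity, ?_⟩, by field_simp; ring⟩
      rw [div_le_one hh]
      have := ht.2
      rw [grid_succ] at this
      linarith
    · have hn0 : 0 < n := by
        rcases Nat.eq_zero_or_pos n with rfl | h0
        · rw [grid_zero] at hn; exact absurd ht.1 (not_le.mpr hn)
        · exact h0
      obtain ⟨i, hi, hc⟩ := ih hn0 ⟨ht.1, hn.le⟩
      exact ⟨i, by omega, hc⟩

theorem coeff_congr {ω' : ℝ → EuclideanSpace ℝ (Fin m)} {s h : ℝ}
    (hω : ∀ c ∈ Icc (0 : ℝ) 1, f (ω (s + c * h)) = g (ω' (s + c * h))) (j : ℕ) :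
    coeff f s h ω j = coeff g s h ω' j := by
  refine intervalIntegral.integral_congr fun τ hτ => ?_
  rw [uIcc_of_le zero_le_one] at hτ
  simp only [hω τ hτ]

theorem IsTruncatedSolution.congr_field (hh : 0 ≤ h)
    (hω : IsTruncatedSolution f r t₀ h N y₀ ω)
    (hfg : ∀ t ∈ Icc t₀ (grid t₀ h N), f (ω t) = g (ω t)) :
    IsTruncatedSolution g r t₀ h N y₀ ω := by
  refine ⟨hω.init, fun i hi c hc => (hω.deriv i hi c hc).congr_deriv ?_⟩
  refine Finset.sum_congr rfl fun j _ => ?_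
  rw [coeff_congr fun c hc => hfg _ (grid_add_mul_mem hh hi hc)]

theorem IsTruncatedSolution.hasDerivWithinAt_step (hh : 0 ≤ h)
    (hω : IsTruncatedSolution f r t₀ h N y₀ ω) {i : ℕ} (hi : i < N) {c : ℝ}
    (hc : c ∈ Icc (0 : ℝ) 1) :
    HasDerivWithinAt (fun c => ω (grid t₀ h i + c * h))
      (h • proj r (fun τ => f (ω (grid t₀ h i + τ * h))) c) (Icc 0 1) c :=
  hasDerivWithinAt_comp_affine hh le_rfl (grid_succ t₀ h i).ge (hω.deriv i hi c hc)

theorem IsTruncatedSolution.continuousOn_step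
    (hh : 0 < h) (hω : IsTruncatedSolution f r t₀ h N y₀ ω) {i : ℕ} (hi : i < N) :
    ContinuousOn ω (Icc (grid t₀ h i) (grid t₀ h (i + 1))) := by
  intro t ht
  have hc : (t - grid t₀ h i) / h ∈ Icc (0 : ℝ) 1 := by
    rw [grid_succ] at ht
    refine ⟨div_nonneg (by linarith [ht.1]) hh.le, ?_⟩
    rw [div_le_one hh]; linarith [ht.2]
  have := (hω.deriv i hi _ hc).continuousWithinAt
  rwa [div_mul_cancel₀ _ hh.ne', add_sub_cancel] at this

theorem IsTruncatedSolution.continuousOn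
    (hh : 0 < h) (hω : IsTruncatedSolution f r t₀ h N y₀ ω) :
    ContinuousOn ω (Icc t₀ (grid t₀ h N)) := by
  have key : ∀ n ≤ N, ContinuousOn ω (Icc t₀ (grid t₀ h n)) := by
    intro n
    induction n with
    | zero => intro _; simp [grid_zero]
    | succ n ih =>
      intro hn
      rw [← Icc_union_Icc_eq_Icc (le_grid hh.le n) (grid_mono hh.le n.le_succ)]
      exact (ih (by omega)).union_of_isClosed (hω.continuousOn_step hh (by omega))
        isClosed_Icc isClosed_Icc
  exact key N le_rfl

theorem exists_derivative_eq (p : ℝ[X]) :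
    ∃ q : ℝ[X], derivative q = p ∧ q.natDegree ≤ p.natDegree + 1 := by
  refine ⟨∑ k ∈ Finset.range (p.natDegree + 1), C (p.coeff k / (k + 1)) * X ^ (k + 1), ?_, ?_⟩
  · conv_rhs => rw [p.as_sum_range_C_mul_X_pow]
    rw [derivative_sum]
    refine Finset.sum_congr rfl fun k _ => ?_
    rw [derivative_C_mul_X_pow]
    have : (k : ℝ) + 1 ≠ 0 := by positivity
    push_cast
    rw [div_mul_cancel₀ _ this]
  · refine natDegree_sum_le_of_forall_le _ _ fun k hk => ?_
    refine (natDegree_C_mul_X_pow_le _ _).trans ?_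
    have := Finset.mem_range.mp hk
    omega

theorem IsTruncatedSolution.isContinuousPiecewisePolynomial (hr : 1 ≤ r) (hh : 0 < h)
    (hω : IsTruncatedSolution f r t₀ h N y₀ ω) :
    IsContinuousPiecewisePolynomial r t₀ h N ω := by
  refine ⟨hω.continuousOn hh, fun i hi => ?_⟩
  have hcomp : ∀ k : Fin m, ∃ p : ℝ[X], p.natDegree ≤ r ∧
      ∀ t ∈ Icc (grid t₀ h i) (grid t₀ h (i + 1)), ω t k = p.eval t := by
    intro k
    set s := grid t₀ h i with hs
    obtain ⟨q, hq, hqd⟩ := exists_derivative_eq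
      (∑ j ∈ Finset.range r, C (coeff f s h ω j k) * legendrePoly j)
    have hdeg : q.natDegree ≤ r := by
      refine hqd.trans ?_
      have : (∑ j ∈ Finset.range r, C (coeff f s h ω j k) * legendrePoly j).natDegree ≤ r - 1 := by
        refine natDegree_sum_le_of_forall_le _ _ fun j hj => ?_
        have := Finset.mem_range.mp hj
        exact (natDegree_C_mul_le _ _).trans ((natDegree_legendrePoly_le j).trans (by omega))
      omega
    have hderiv : ∀ c ∈ Icc (0 : ℝ) 1,
        HasDerivWithinAt (fun c => ω (s + c * h) k - h * q.eval c) 0 (Icc 0 1) c := by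
      intro c hc
      have h1 := (EuclideanSpace.proj (𝕜 := ℝ) k).hasFDerivAt.comp_hasDerivWithinAt c
        (hω.hasDerivWithinAt_step hh.le hi hc)
      have h2 := ((q.hasDerivAt c).const_mul h).hasDerivWithinAt (s := Icc 0 1)
      refine (h1.sub h2).congr_deriv ?_
      rw [hq, sub_eq_zero, map_smul, smul_eq_mul]
      congr 1
      rw [proj, map_sum, eval_finsetSum]
      refine Finset.sum_congr rfl fun j _ => ?_
      rw [map_smul, eval_mul, eval_C, eval_legendrePoly, smul_eq_mul, mul_comm]
      rfl
    -- `q` is an antiderivative in the variable `c`; substituting `c = (t - s) / h` returns to `t`,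
    -- and the constant matches the value at `s`.
    refine ⟨(C (ω s k - h * q.eval 0) + C h * q).comp (C h⁻¹ * (X - C s)), ?_, ?_⟩
    · refine natDegree_comp_le.trans ?_
      have h1 : (C (ω s k - h * q.eval 0) + C h * q).natDegree ≤ r := by
        refine (natDegree_add_le _ _).trans (max_le ((natDegree_C _).trans_le r.zero_le) ?_)
        exact (natDegree_C_mul_le _ _).trans hdeg
      have h2 : (C h⁻¹ * (X - C s)).natDegree ≤ 1 :=
        (natDegree_C_mul_le _ _).trans (natDegree_X_sub_C_le s)
      nlinarith
    · intro t ht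
      have hc : h⁻¹ * (t - s) ∈ Icc (0 : ℝ) 1 := by
        rw [grid_succ] at ht
        refine ⟨mul_nonneg (by positivity) (by linarith [ht.1]), ?_⟩
        rw [inv_mul_le_iff₀ hh]; linarith [ht.2]
      have hmv := (convex_Icc (0 : ℝ) 1).norm_image_sub_le_of_norm_hasDerivWithin_le (C := 0)
        hderiv (fun _ _ => by simp) ⟨le_rfl, zero_le_one⟩ hc
      have hst : s + h⁻¹ * (t - s) * h = t := by field_simp; ring
      rw [hst, zero_mul, zero_mul, norm_le_zero_iff, add_zero] at hmv
      simp only [eval_comp, eval_add, eval_mul, eval_C, eval_sub, eval_X]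
      linarith
  choose p hp using hcomp
  exact ⟨p, fun k => (hp k).1, fun t ht k => (hp k).2 t ht⟩

/-- Here `v` solves the truncated equation up to the defect `ρ`. The lemma serves twice: `ρ = 0`
yields uniqueness, and `v = y` yields convergence of order `r`. -/
theorem exists_stability_constant (r : ℕ) (L : ℝ) (hL : 0 ≤ L) (T : ℝ) (hT : 0 ≤ T) :
    ∃ C h₁ : ℝ, 0 ≤ C ∧ 0 < h₁ ∧ ∀ {m : ℕ}
      {g : EuclideanSpace ℝ (Fin m) → EuclideanSpace ℝ (Fin m)}, Continuous g →
      (∀ x y, ‖g x - g y‖ ≤ L * ‖x - y‖) →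
      ∀ {N : ℕ} {t₀ h η : ℝ} {y₀ : EuclideanSpace ℝ (Fin m)}
        {u v : ℝ → EuclideanSpace ℝ (Fin m)} {ρ : ℕ → ℝ → EuclideanSpace ℝ (Fin m)},
      0 < h → h ≤ h₁ → N * h = T → 0 < N → 0 ≤ η → IsTruncatedSolution g r t₀ h N y₀ u →
      v t₀ = y₀ →
      (∀ i < N, ∀ c ∈ Icc (0 : ℝ) 1, HasDerivWithinAt (fun c => v (grid t₀ h i + c * h))
        (h • (proj r (fun τ => g (v (grid t₀ h i + τ * h))) c + ρ i c)) (Icc 0 1) c) →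
      (∀ i < N, ∀ c ∈ Icc (0 : ℝ) 1, ‖ρ i c‖ ≤ η) →
      ∀ t ∈ Icc t₀ (grid t₀ h N), ‖u t - v t‖ ≤ C * η := by
  obtain ⟨B, hB0, hB⟩ := exists_norm_proj_le r
  have hα : 0 ≤ 2 * (B * L) := by positivity
  -- Gronwall with `N * h = T` bounds the error at the nodes; the outer factor and `+ 2` pay for one
  -- further partial step, using `h ≤ 1`.
  refine ⟨(1 + 2 * (B * L)) * (T * Real.exp (T * (2 * (B * L))) * 2) + 2,
    min 1 (1 / (2 * (B * L) + 1)), by positivity, by positivity, ?_⟩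
  intro m g hgc hg N t₀ h η y₀ u v ρ hh hle hNh hN hη hu hv0 hv hρ t ht
  have hh1 : h ≤ 1 := hle.trans (min_le_left _ _)
  have hsmall : h * (B * L) ≤ 1 / 2 := by
    have h1 : h ≤ 1 / (2 * (B * L) + 1) := hle.trans (min_le_right _ _)
    rw [le_div_iff₀ (by positivity)] at h1
    linarith
  have step : ∀ i < N, ∀ c ∈ Icc (0 : ℝ) 1,
      ‖u (grid t₀ h i + c * h) - v (grid t₀ h i + c * h)‖ ≤
        (1 + 2 * (h * (B * L))) * ‖u (grid t₀ h i) - v (grid t₀ h i)‖ + 2 * (h * η) := by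
    intro i hi c hc
    have := step_stability hB0 hL (fun φ M => hB φ M) hgc hg hh.le hη hsmall
      (fun c hc => hu.hasDerivWithinAt_step hh.le hi hc) (hv i hi) (hρ i hi) c hc
    simpa using this
  have hgr := discrete_gronwall (a := fun i => ‖u (grid t₀ h i) - v (grid t₀ h i)‖)
    (x := 2 * (h * (B * L))) (d := 2 * (h * η)) (N := N) (by positivity) (by positivity)
    (by simp [grid_zero, hu.init, hv0]) (fun i hi => by
      have := step i hi 1 ⟨zero_le_one, le_rfl⟩
      rwa [one_mul, ← grid_succ] at this)
  have hexp : (N : ℝ) * (2 * (h * (B * L))) = T * (2 * (B * L)) := by rw [← hNh]; ring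
  have hgr' : ∀ i ≤ N, ‖u (grid t₀ h i) - v (grid t₀ h i)‖ ≤
      T * Real.exp (T * (2 * (B * L))) * 2 * η := by
    intro i hi
    refine (hgr i hi).trans (le_of_eq ?_)
    rw [hexp, ← hNh]; ring
  obtain ⟨i, hi, c, hc, rfl⟩ := exists_grid_add_mul_eq hh hN ht
  have hW : 0 ≤ T * Real.exp (T * (2 * (B * L))) * 2 := by positivity
  calc _ ≤ (1 + 2 * (h * (B * L))) * ‖u (grid t₀ h i) - v (grid t₀ h i)‖ + 2 * (h * η) :=
        step i hi c hc
    _ ≤ (1 + 2 * (1 * (B * L))) * (T * Real.exp (T * (2 * (B * L))) * 2 * η) + 2 * (1 * η) := by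
        gcongr
        exact hgr' i hi.le
    _ = _ := by ring

end Solutions

/-! ### Existence for a globally Lipschitz field. -/

section Existence

variable {E : Type*} [NormedAddCommGroup E] [NormedSpace ℝ E] [CompleteSpace E]

/-- A solution on one step is determined by its `r` coefficients `γ`, through integrated Legendre
polynomials. Recomputing the coefficients from the resulting curve is a contraction of `Fin r → E`
for small `h`. The threshold is independent of the starting value, so steps can be chained. -/
theorem exists_step (r : ℕ) (L : ℝ) (hL : 0 ≤ L) :
    ∃ h₁ : ℝ, 0 < h₁ ∧ ∀ {g : E → E}, Continuous g → (∀ x y, ‖g x - g y‖ ≤ L * ‖x - y‖) →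
      ∀ h : ℝ, 0 ≤ h → h ≤ h₁ → ∀ x : E, ∃ ψ : ℝ → E, ψ 0 = x ∧
        ∀ c, HasDerivAt ψ (h • proj r (fun τ => g (ψ τ)) c) c := by
  obtain ⟨b, hb0, hb⟩ := exists_norm_legendre_le r
  refine ⟨1 / (2 * (b * L * (r * b)) + 1), by positivity, ?_⟩
  intro g hgc hg h hh hle x
  have hsmall : b * L * (h * (r * b)) ≤ 1 / 2 := by
    rw [le_div_iff₀ (by positivity)] at hle
    linarith
  set Q : ℕ → ℝ → ℝ := fun j c => ∫ τ in (0 : ℝ)..c, legendre j τ with hQ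
  have hQd : ∀ j c, HasDerivAt (Q j) (legendre j c) c := fun j c =>
    (continuous_legendre j).integral_hasStrictDerivAt 0 c |>.hasDerivAt
  have hQb : ∀ j < r, ∀ c ∈ Icc (0 : ℝ) 1, ‖Q j c‖ ≤ b := by
    intro j hj c hc
    have := intervalIntegral.norm_integral_le_of_norm_le_const (a := (0 : ℝ)) (b := c) (C := b)
      (f := legendre j) (fun τ hτ => by
        rw [uIoc_of_le hc.1] at hτ
        exact hb j hj τ ⟨hτ.1.le, hτ.2.trans hc.2⟩)
    refine this.trans ?_
    rw [sub_zero, abs_of_nonneg hc.1]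
    exact mul_le_of_le_one_right hb0 hc.2
  set ψ : (Fin r → E) → ℝ → E := fun γ c => x + h • ∑ j : Fin r, Q j c • γ j with hψ
  have hψd : ∀ γ c, HasDerivAt (ψ γ) (h • ∑ j : Fin r, legendre j c • γ j) c := fun γ c =>
    ((HasDerivAt.fun_sum fun (j : Fin r) _ => (hQd j c).smul_const (γ j)).const_smul h).const_add x
  have hψc : ∀ γ, Continuous (ψ γ) := fun γ =>
    continuous_iff_continuousAt.mpr fun c => (hψd γ c).continuousAt
  have hψlip : ∀ γ γ', ∀ c ∈ Icc (0 : ℝ) 1, ‖ψ γ c - ψ γ' c‖ ≤ h * (r * b) * ‖γ - γ'‖ := by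
    intro γ γ' c hc
    have e : ψ γ c - ψ γ' c = h • ∑ j : Fin r, Q j c • (γ - γ') j := by
      simp only [hψ, add_sub_add_left_eq_sub, ← smul_sub, ← Finset.sum_sub_distrib, Pi.sub_apply]
    rw [e, norm_smul, Real.norm_of_nonneg hh, mul_assoc]
    refine mul_le_mul_of_nonneg_left ?_ hh
    have : ∀ j ∈ Finset.univ, ‖Q (j : Fin r) c • (γ - γ') j‖ ≤ b * ‖γ - γ'‖ := by
      intro j _
      rw [norm_smul]
      exact mul_le_mul (hQb j j.2 c hc) (norm_le_pi_norm _ j) (norm_nonneg _) hb0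
    refine (norm_sum_le_of_le _ this).trans ?_
    simp [mul_assoc]
  set Φ : (Fin r → E) → (Fin r → E) := fun γ j =>
    ∫ τ in (0 : ℝ)..1, legendre j τ • g (ψ γ τ) with hΦ
  have hcontr : ContractingWith (1 / 2) Φ := by
    refine ⟨by norm_num, LipschitzWith.of_dist_le_mul fun γ γ' => ?_⟩
    rw [dist_eq_norm, dist_eq_norm]
    refine (pi_norm_le_iff_of_nonneg (by positivity)).mpr fun j => ?_
    have e : (Φ γ - Φ γ') j =
        ∫ τ in (0 : ℝ)..1, legendre j τ • (g (ψ γ τ) - g (ψ γ' τ)) := by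
      simp only [hΦ, Pi.sub_apply, smul_sub]
      rw [intervalIntegral.integral_sub
        (intervalIntegrable_smul (φ := fun τ => g (ψ γ τ)) (hgc.comp (hψc γ)).continuousOn
          (continuous_legendre j))
        (intervalIntegrable_smul (φ := fun τ => g (ψ γ' τ)) (hgc.comp (hψc γ')).continuousOn
          (continuous_legendre j))]
    rw [e]
    have h1 := norm_integral_legendre_smul_le (φ := fun τ => g (ψ γ τ) - g (ψ γ' τ))
      (M := L * (h * (r * b) * ‖γ - γ'‖)) (hb j j.2) hb0 (fun c hc =>
        (hg _ _).trans (mul_le_mul_of_nonneg_left (hψlip γ γ' c hc) hL))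
    refine h1.trans ?_
    calc _ = b * L * (h * (r * b)) * ‖γ - γ'‖ := by ring
      _ ≤ 1 / 2 * ‖γ - γ'‖ := mul_le_mul_of_nonneg_right hsmall (norm_nonneg _)
      _ = _ := by norm_num
  obtain ⟨γ, hγ⟩ : ∃ γ, Φ γ = γ := ⟨_, hcontr.fixedPoint_isFixedPt⟩
  refine ⟨ψ γ, by simp [hψ, hQ], fun c => (hψd γ c).congr_deriv ?_⟩
  rw [proj, Finset.sum_range]
  congr 1
  refine Finset.sum_congr rfl fun j _ => ?_
  conv_lhs => rw [← hγ]

/-- Glue the steps. Since `ψ 0` is the value reached so far, both formulas agree at the junction,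
and the one-sided derivatives of earlier steps never see the new piece. -/
theorem exists_isTruncatedSolution (m r : ℕ) (L : ℝ) (hL : 0 ≤ L) :
    ∃ h₁ : ℝ, 0 < h₁ ∧ ∀ {g : EuclideanSpace ℝ (Fin m) → EuclideanSpace ℝ (Fin m)},
      Continuous g → (∀ x y, ‖g x - g y‖ ≤ L * ‖x - y‖) →
      ∀ (t₀ h : ℝ) (y₀ : EuclideanSpace ℝ (Fin m)) (N : ℕ), 0 < h → h ≤ h₁ →
        ∃ ω, IsTruncatedSolution g r t₀ h N y₀ ω := by
  obtain ⟨h₁, hh₁, hstep⟩ := exists_step (E := EuclideanSpace ℝ (Fin m)) r L hL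
  refine ⟨h₁, hh₁, fun {g} hgc hg t₀ h y₀ N hh hle => ?_⟩
  induction N with
  | zero => exact ⟨fun _ => y₀, rfl, fun i hi => absurd hi (Nat.not_lt_zero i)⟩
  | succ n ih =>
    obtain ⟨ω, hω⟩ := ih
    obtain ⟨ψ, hψ0, hψ⟩ := hstep hgc hg h hh.le hle (ω (grid t₀ h n))
    set ω' : ℝ → EuclideanSpace ℝ (Fin m) := fun t =>
      if t ≤ grid t₀ h n then ω t else ψ ((t - grid t₀ h n) / h) with hω'
    have hleft : ∀ t ≤ grid t₀ h n, ω' t = ω t := fun t ht => if_pos ht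
    have hright : ∀ t, grid t₀ h n ≤ t → ω' t = ψ ((t - grid t₀ h n) / h) := by
      intro t ht
      rcases ht.eq_or_lt with rfl | ht
      · rw [hleft _ le_rfl, sub_self, zero_div, hψ0]
      · exact if_neg (not_le.mpr ht)
    refine ⟨ω', (hleft _ (le_grid hh.le n)).trans hω.init, fun i hi c hc => ?_⟩
    rcases Nat.lt_succ_iff_lt_or_eq.mp hi with hi | rfl
    · have hin : grid t₀ h (i + 1) ≤ grid t₀ h n := grid_mono hh.le hi
      have hmem : ∀ c ∈ Icc (0 : ℝ) 1, grid t₀ h i + c * h ≤ grid t₀ h n := fun c hc =>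
        (add_mul_mem_Icc hh.le le_rfl (grid_succ t₀ h i).ge hc).2.trans hin
      refine ((hω.deriv i hi c hc).congr (fun t ht => hleft t (ht.2.trans hin))
        (hleft _ (hmem c hc))).congr_deriv ?_
      refine Finset.sum_congr rfl fun j _ => ?_
      rw [coeff_congr (g := g) (ω' := ω') fun c hc => by rw [hleft _ (hmem c hc)]]
    · have hpt : ∀ c : ℝ, (grid t₀ h i + c * h - grid t₀ h i) / h = c := fun c => by
        rw [add_sub_cancel_left, mul_div_cancel_right₀ _ hh.ne']
      have hval : ∀ c ∈ Icc (0 : ℝ) 1, ω' (grid t₀ h i + c * h) = ψ c := fun c hc => by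
        rw [hright _ (by nlinarith [mul_nonneg hc.1 hh.le]), hpt]
      have hd : HasDerivAt (fun t => ψ ((t - grid t₀ h i) / h))
          (proj r (fun τ => g (ψ τ)) c) (grid t₀ h i + c * h) := by
        have h1 : HasDerivAt (fun t : ℝ => (t - grid t₀ h i) / h) (1 / h)
            (grid t₀ h i + c * h) :=
          ((hasDerivAt_id _).sub_const _).div_const h
        have h2 := hψ c
        rw [← hpt c] at h2
        refine (HasDerivAt.scomp (h := fun t : ℝ => (t - grid t₀ h i) / h) _ h2 h1).congr_deriv ?_
        rw [smul_smul, one_div, inv_mul_cancel₀ hh.ne', one_smul, hpt]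
      refine (hd.hasDerivWithinAt.congr (fun t ht => hright t ht.1)
        (hright _ (by nlinarith [mul_nonneg hc.1 hh.le]))).congr_deriv ?_
      refine Finset.sum_congr rfl fun j _ => ?_
      congr 1
      refine intervalIntegral.integral_congr fun τ hτ => ?_
      rw [uIcc_of_le zero_le_one] at hτ
      simp only [hval τ hτ]

end Existence

/-! ### The linearized error equation and the gain of `r` powers of `h`. -/

section LinearizedError

open scoped ContDiff

variable {E : Type*} [NormedAddCommGroup E] [NormedSpace ℝ E]

/-- On the step `[s, s + h]`, in the rescaled variable `c ∈ [0,1]`, the error `ε` solves the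
linearized equation `ε' = h (A ε + q - R)`, where `q` is the quadratic remainder and `R` is the
part of the vector field lost by the truncation. -/
structure IsLinearizedError (r : ℕ) (A : ℝ → E →L[ℝ] E) (D s h : ℝ) (ε q R : ℝ → E) : Prop where
  continuousOn_q : ContinuousOn q (Icc 0 1)
  continuousOn_R : ContinuousOn R (Icc 0 1)
  deriv : ∀ c ∈ Icc (0 : ℝ) 1,
    HasDerivWithinAt ε (h • (A (s + c * h) (ε c) + q c - R c)) (Icc 0 1) c
  norm_le : ∀ c ∈ Icc (0 : ℝ) 1, ‖ε c‖ ≤ D * h ^ r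
  norm_q_le : ∀ c ∈ Icc (0 : ℝ) 1, ‖q c‖ ≤ D * h ^ (2 * r)
  norm_R_le : ∀ c ∈ Icc (0 : ℝ) 1, ‖R c‖ ≤ D * h ^ r
  orthogonal : ∀ p : ℝ[X], p.degree < r → ∫ c in (0 : ℝ)..1, p.eval c • R c = 0

theorem IsLinearizedError.continuousOn {r : ℕ} {A : ℝ → E →L[ℝ] E} {D s h : ℝ} {ε q R : ℝ → E}
    (H : IsLinearizedError r A D s h ε q R) : ContinuousOn ε (Icc 0 1) :=
  fun c hc => (H.deriv c hc).continuousWithinAt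

theorem norm_integral_one_sub_pow_smul_clm_le {k : ℕ} {M η : ℝ} {G : ℝ → E →L[ℝ] E} {φ : ℝ → E}
    (hG : ∀ c ∈ Icc (0 : ℝ) 1, ‖G c‖ ≤ M) (hφ : ∀ c ∈ Icc (0 : ℝ) 1, ‖φ c‖ ≤ η) :
    ‖∫ c in (0 : ℝ)..1, (1 - c) ^ k • G c (φ c)‖ ≤ M * η := by
  have := intervalIntegral.norm_integral_le_of_norm_le_const (a := (0 : ℝ)) (b := 1)
    (C := M * η) (f := fun c => (1 - c) ^ k • G c (φ c)) (fun c hc => by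
      rw [uIoc_of_le zero_le_one] at hc
      have hc' := Ioc_subset_Icc_self hc
      have h1 : ‖(1 - c) ^ k‖ ≤ 1 := by
        rw [norm_pow]
        refine pow_le_one₀ (norm_nonneg _) ?_
        rw [Real.norm_of_nonneg (by linarith [hc'.2])]
        linarith [hc'.1]
      have h2 := ContinuousLinearMap.le_of_opNorm_le_of_le _ (hG c hc') (hφ c hc')
      rw [norm_smul]
      nlinarith [norm_nonneg (G c (φ c))])
  simpa using this

theorem integral_smul_add_sub_sub_smul {u₀ u₁ u₂ u₃ : ℝ → E} (h κ : ℝ)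
    (i₁ : IntervalIntegrable u₁ MeasureTheory.volume 0 1)
    (i₂ : IntervalIntegrable u₂ MeasureTheory.volume 0 1)
    (i₃ : IntervalIntegrable u₃ MeasureTheory.volume 0 1)
    (i₀ : IntervalIntegrable u₀ MeasureTheory.volume 0 1) :
    ∫ c in (0 : ℝ)..1, (h • (u₁ c + u₂ c - u₃ c) - κ • u₀ c) =
      h • ((∫ c in (0 : ℝ)..1, u₁ c) + (∫ c in (0 : ℝ)..1, u₂ c) - ∫ c in (0 : ℝ)..1, u₃ c) -
        κ • ∫ c in (0 : ℝ)..1, u₀ c := by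
  have e1 := intervalIntegral.integral_sub (((i₁.add i₂).sub i₃).smul h) (i₀.smul κ)
  have e2 := intervalIntegral.integral_sub (i₁.add i₂) i₃
  have e3 := intervalIntegral.integral_add i₁ i₂
  simp only [Pi.smul_apply] at e1
  rw [e1, intervalIntegral.integral_smul, intervalIntegral.integral_smul, e2, e3]

variable [CompleteSpace E]

/-- Integrate the derivative of `(1 - c) ^ (k + 1) • G ε` over `[0, 1]` and insert the equation for
`ε`. The weight kills the boundary term at `1`; everything except `G s (ε 0)` carries a factor `h`.
-/
theorem integral_one_sub_pow_smul_clm {r k : ℕ} {A G : ℝ → E →L[ℝ] E} {a b D s h : ℝ}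
    {ε q R : ℝ → E} (hab : a < b) (hA : ContinuousOn A (Icc a b))
    (hG : ContDiffOn ℝ 1 G (Icc a b)) (hh : 0 ≤ h) (hs : a ≤ s) (hsb : s + h ≤ b)
    (H : IsLinearizedError r A D s h ε q R) :
    ((k : ℝ) + 1) • ∫ c in (0 : ℝ)..1, (1 - c) ^ k • G (s + c * h) (ε c) =
      G s (ε 0) + h • ((∫ c in (0 : ℝ)..1, (1 - c) ^ (k + 1) •
          (derivWithin G (Icc a b) (s + c * h) + G (s + c * h) ∘L A (s + c * h)) (ε c)) +
        (∫ c in (0 : ℝ)..1, (1 - c) ^ (k + 1) • G (s + c * h) (q c)) -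
        ∫ c in (0 : ℝ)..1, (1 - c) ^ (k + 1) • G (s + c * h) (R c)) := by
  have hud := uniqueDiffOn_Icc hab
  have hGd : ContinuousOn (derivWithin G (Icc a b)) (Icc a b) :=
    hG.continuousOn_derivWithin hud le_rfl
  have hGc := continuousOn_comp_affine hh hs hsb hG.continuousOn
  have hAc := continuousOn_comp_affine hh hs hsb hA
  have hdGc := continuousOn_comp_affine hh hs hsb hGd
  have hi : ∀ (j : ℕ) {B : ℝ → E →L[ℝ] E} {φ : ℝ → E}, ContinuousOn B (Icc 0 1) →
      ContinuousOn φ (Icc 0 1) → IntervalIntegrable (fun c => (1 - c) ^ j • B c (φ c))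
        MeasureTheory.volume 0 1 := fun j B φ hB hφ =>
    intervalIntegrable_smul (hB.clm_apply hφ) (by fun_prop)
  have i0 := hi k hGc H.continuousOn
  have i1 : IntervalIntegrable (fun c => (1 - c) ^ (k + 1) •
      (derivWithin G (Icc a b) (s + c * h) + G (s + c * h) ∘L A (s + c * h)) (ε c))
      MeasureTheory.volume 0 1 := hi (k + 1) (hdGc.add (hGc.clm_comp hAc)) H.continuousOn
  have i2 := hi (k + 1) hGc H.continuousOn_q
  have i3 := hi (k + 1) hGc H.continuousOn_R
  have hderiv : ∀ c ∈ Icc (0 : ℝ) 1, HasDerivWithinAt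
      (fun c => (1 - c) ^ (k + 1) • G (s + c * h) (ε c))
      (h • ((1 - c) ^ (k + 1) •
          (derivWithin G (Icc a b) (s + c * h) + G (s + c * h) ∘L A (s + c * h)) (ε c) +
        (1 - c) ^ (k + 1) • G (s + c * h) (q c) - (1 - c) ^ (k + 1) • G (s + c * h) (R c)) -
        ((k : ℝ) + 1) • (1 - c) ^ k • G (s + c * h) (ε c)) (Icc 0 1) c := by
    intro c hc
    have h1 := hasDerivWithinAt_comp_affine hh hs hsb
      ((hG.differentiableOn one_ne_zero _ (add_mul_mem_Icc hh hs hsb hc)).hasDerivWithinAt)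
    have h2 := h1.clm_apply (H.deriv c hc)
    have h3 : HasDerivAt (fun c : ℝ => (1 - c) ^ (k + 1)) (-((k + 1) * (1 - c) ^ k)) c := by
      have := ((hasDerivAt_id c).const_sub 1).pow (k + 1)
      refine this.congr_deriv ?_
      simp
    refine (h3.hasDerivWithinAt.smul h2).congr_deriv ?_
    simp only [_root_.add_apply, _root_.smul_apply, ContinuousLinearMap.comp_apply, map_smul,
      map_add, map_sub]
    module
  have hcont : ContinuousOn (fun c => (1 - c) ^ (k + 1) • G (s + c * h) (ε c)) (Icc 0 1) :=
    fun c hc => (hderiv c hc).continuousWithinAt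
  have hint := intervalIntegral.integral_eq_sub_of_hasDerivAt_of_le zero_le_one hcont
    (fun c hc => (hderiv c (Ioo_subset_Icc_self hc)).hasDerivAt (Icc_mem_nhds hc.1 hc.2))
    ((((i1.add i2).sub i3).smul h).sub (i0.smul ((k : ℝ) + 1)))
  rw [integral_smul_add_sub_sub_smul h _ i1 i2 i3 i0] at hint
  simp only [sub_self, zero_mul, add_zero, sub_zero, one_pow, one_smul, ne_eq,
    Nat.succ_ne_zero, not_false_eq_true, zero_pow, zero_smul, zero_sub] at hint
  rw [sub_eq_iff_eq_add] at hint
  rw [hint]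
  abel

/-- Each use of the integrated identity replaces `G` by `G' + G ∘ A` and trades one unit of `l` for
one of `k`. The constraint `k + l = r` leaves just enough orthogonality for the `R` term to be
`O(h^(r+l))` before multiplication by `h`. Smoothness of infinite order lets the family of
admissible `G` be closed under this operation. -/
theorem exists_norm_integral_one_sub_pow_smul_clm_le {a b : ℝ} (hab : a < b) {r : ℕ}
    {A : ℝ → E →L[ℝ] E} (hA : ContDiffOn ℝ ∞ A (Icc a b)) {D : ℝ} (hD : 0 ≤ D) :
    ∀ l k : ℕ, k + l = r → ∀ G : ℝ → E →L[ℝ] E, ContDiffOn ℝ ∞ G (Icc a b) →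
      ∃ C : ℝ, 0 ≤ C ∧ ∀ s h : ℝ, 0 ≤ h → h ≤ 1 → a ≤ s → s + h ≤ b → ∀ ε q R : ℝ → E,
        IsLinearizedError r A D s h ε q R →
        ‖∫ c in (0 : ℝ)..1, (1 - c) ^ k • G (s + c * h) (ε c)‖ ≤ C * (‖ε 0‖ + h ^ (r + l)) := by
  intro l
  induction l with
  | zero =>
    intro k hk G hG
    obtain ⟨M, hM⟩ := isCompact_Icc.exists_bound_of_continuousOn hG.continuousOn
    have hM0 : 0 ≤ M := (norm_nonneg _).trans (hM a ⟨le_rfl, hab.le⟩)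
    refine ⟨M * D, by positivity, fun s h hh hh1 hs hsb ε q R H => ?_⟩
    refine (norm_integral_one_sub_pow_smul_clm_le
      (fun c hc => hM _ (add_mul_mem_Icc hh hs hsb hc)) H.norm_le).trans ?_
    rw [add_zero, ← mul_assoc]
    exact mul_le_mul_of_nonneg_left (le_add_of_nonneg_left (norm_nonneg _)) (by positivity)
  | succ l ih =>
    intro k hk G hG
    have hud := uniqueDiffOn_Icc hab
    obtain ⟨M, hM⟩ := isCompact_Icc.exists_bound_of_continuousOn hG.continuousOn
    have hM0 : 0 ≤ M := (norm_nonneg _).trans (hM a ⟨le_rfl, hab.le⟩)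
    obtain ⟨C₁, hC₁0, hC₁⟩ := ih (k + 1) (by omega)
      (fun t => derivWithin G (Icc a b) t + G t ∘L A t)
      (((contDiffOn_infty_iff_derivWithin hud).mp hG).2.add (hG.clm_comp hA))
    obtain ⟨C₂, hC₂0, hC₂⟩ := exists_norm_integral_smul_clm_le hab (r := r) (k := k + 1) (l := l)
      (by omega) (hG.of_le (by exact_mod_cast le_top))
    refine ⟨M + C₁ + M * D + C₂ * D, by positivity, fun s h hh hh1 hs hsb ε q R H => ?_⟩
    have key := integral_one_sub_pow_smul_clm (k := k) hab hA.continuousOn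
      (hG.of_le (by exact_mod_cast le_top)) hh hs hsb H
    have b1 := hC₁ s h hh hh1 hs hsb ε q R H
    have b2 := norm_integral_one_sub_pow_smul_clm_le (k := k + 1)
      (fun c hc => hM _ (add_mul_mem_Icc hh hs hsb hc)) H.norm_q_le
    have b3 := hC₂ s h hh hs hsb R _ H.continuousOn_R H.norm_R_le H.orthogonal
    have b4 : ‖G s (ε 0)‖ ≤ M * ‖ε 0‖ :=
      ContinuousLinearMap.le_of_opNorm_le _ (hM s ⟨hs, by linarith⟩) _
    generalize (∫ c in (0 : ℝ)..1, (1 - c) ^ (k + 1) •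
      (derivWithin G (Icc a b) (s + c * h) + G (s + c * h) ∘L A (s + c * h)) (ε c)) = I₁ at key b1
    generalize (∫ c in (0 : ℝ)..1, (1 - c) ^ (k + 1) • G (s + c * h) (q c)) = I₂ at key b2
    generalize (∫ c in (0 : ℝ)..1, (1 - c) ^ (k + 1) • G (s + c * h) (R c)) = I₃ at key b3
    generalize (∫ c in (0 : ℝ)..1, (1 - c) ^ k • G (s + c * h) (ε c)) = I₀ at key
    have hle : ‖I₀‖ ≤ ‖((k : ℝ) + 1) • I₀‖ := by
      rw [norm_smul, Real.norm_of_nonneg (by positivity)]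
      exact le_mul_of_one_le_left (norm_nonneg _) (by linarith [Nat.cast_nonneg (α := ℝ) k])
    have htri : ‖G s (ε 0) + h • (I₁ + I₂ - I₃)‖ ≤
        ‖G s (ε 0)‖ + h * (‖I₁‖ + ‖I₂‖ + ‖I₃‖) := by
      refine (norm_add_le _ _).trans ?_
      rw [norm_smul, Real.norm_of_nonneg hh]
      gcongr
      exact (norm_sub_le _ _).trans (by gcongr; exact norm_add_le _ _)
    have hpow : h ^ (2 * r) ≤ h ^ (r + l) := pow_le_pow_of_le_one hh hh1 (by omega)
    have e1 : h ^ (r + (l + 1)) = h * h ^ (r + l) := by ring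
    rw [key] at hle
    have hε := norm_nonneg (ε 0)
    have hp : 0 ≤ h ^ (r + l) := by positivity
    have b2' : ‖I₂‖ ≤ M * (D * h ^ (r + l)) := b2.trans (by gcongr)
    have b3' : ‖I₃‖ ≤ C₂ * D * h ^ (r + l) := b3.trans (le_of_eq (by ring))
    calc ‖I₀‖ ≤ M * ‖ε 0‖ + h * (C₁ * (‖ε 0‖ + h ^ (r + l)) + M * (D * h ^ (r + l)) +
          C₂ * D * h ^ (r + l)) := (hle.trans htri).trans (by gcongr)
      _ = M * ‖ε 0‖ + C₁ * (h * ‖ε 0‖) + (C₁ + M * D + C₂ * D) * (h * h ^ (r + l)) := by ring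
      _ ≤ (M + C₁ + M * D + C₂ * D) * ‖ε 0‖ + (M + C₁ + M * D + C₂ * D) * (h * h ^ (r + l)) := by
          have : h * ‖ε 0‖ ≤ ‖ε 0‖ := mul_le_of_le_one_left hε hh1
          have h1 : M * ‖ε 0‖ + C₁ * (h * ‖ε 0‖) ≤ (M + C₁ + M * D + C₂ * D) * ‖ε 0‖ := by
            have := mul_le_mul_of_nonneg_left this hC₁0
            have : 0 ≤ (M * D + C₂ * D) * ‖ε 0‖ := by positivity
            linarith
          have h2 : 0 ≤ M * (h * h ^ (r + l)) := by positivity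
          linarith
      _ = _ := by rw [e1]; ring

/-- The case `k = 0`, `l = r`, `G = A` of the preceding bound, together with `∫ R = 0`, which holds
because constants have degree less than `r`. -/
theorem exists_step_error_le {a b : ℝ} (hab : a < b) {r : ℕ} (hr : 1 ≤ r)
    {A : ℝ → E →L[ℝ] E} (hA : ContDiffOn ℝ ∞ A (Icc a b)) {D : ℝ} (hD : 0 ≤ D) :
    ∃ C : ℝ, 0 ≤ C ∧ ∀ s h : ℝ, 0 ≤ h → h ≤ 1 → a ≤ s → s + h ≤ b → ∀ ε q R : ℝ → E,
      IsLinearizedError r A D s h ε q R →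
      ‖ε 1‖ ≤ (1 + h * C) * ‖ε 0‖ + h * (C * h ^ (2 * r)) := by
  obtain ⟨C, hC0, hC⟩ := exists_norm_integral_one_sub_pow_smul_clm_le hab hA hD r 0 (zero_add r)
    A hA
  refine ⟨C + D, by positivity, fun s h hh hh1 hs hsb ε q R H => ?_⟩
  have hAε := hC s h hh hh1 hs hsb ε q R H
  simp only [pow_zero, one_smul] at hAε
  have hAc := continuousOn_comp_affine hh hs hsb hA.continuousOn
  have hi : ∀ {φ : ℝ → E}, ContinuousOn φ (Icc 0 1) →
      IntervalIntegrable φ MeasureTheory.volume 0 1 := fun hφ =>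
    ContinuousOn.intervalIntegrable (by rwa [uIcc_of_le zero_le_one])
  have i1 := hi (hAc.clm_apply H.continuousOn)
  have i2 := hi H.continuousOn_q
  have i3 := hi H.continuousOn_R
  have hint := intervalIntegral.integral_eq_sub_of_hasDerivAt_of_le zero_le_one H.continuousOn
    (fun c hc => (H.deriv c (Ioo_subset_Icc_self hc)).hasDerivAt (Icc_mem_nhds hc.1 hc.2))
    (((i1.add i2).sub i3).smul h)
  have hsplit := integral_smul_add_sub_sub_smul h 0 i1 i2 i3 i1
  simp only [zero_smul, sub_zero] at hsplit
  have hR : ∫ c in (0 : ℝ)..1, R c = 0 := by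
    simpa using H.orthogonal 1 (by rw [degree_one]; exact_mod_cast hr)
  have hq : ‖∫ c in (0 : ℝ)..1, q c‖ ≤ D * h ^ (2 * r) := by
    have := intervalIntegral.norm_integral_le_of_norm_le_const (a := (0 : ℝ)) (b := 1)
      (C := D * h ^ (2 * r)) (f := q) (fun c hc => by
        rw [uIoc_of_le zero_le_one] at hc
        exact H.norm_q_le c (Ioc_subset_Icc_self hc))
    simpa using this
  rw [hsplit, hR, sub_zero] at hint
  rw [eq_add_of_sub_eq hint.symm]
  refine (norm_add_le _ _).trans ?_
  rw [norm_smul, Real.norm_of_nonneg hh]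
  have hsum := (norm_add_le (∫ c in (0 : ℝ)..1, A (s + c * h) (ε c))
    (∫ c in (0 : ℝ)..1, q c)).trans (add_le_add hAε hq)
  rw [← two_mul] at hsum
  have h1 := mul_le_mul_of_nonneg_left hsum hh
  have h2 : 0 ≤ h * D * ‖ε 0‖ := by positivity
  linarith

end LinearizedError

/-! ### Convergence of order `r` on the interval and `2r` on the grid. -/

section Convergence

open scoped ContDiff

theorem exists_lipschitzOnWith_of_isCompact {E F : Type*} [NormedAddCommGroup E] [NormedSpace ℝ E]
    [NormedAddCommGroup F] [NormedSpace ℝ F] {f : E → F} {K : Set E} (hK : IsCompact K)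
    (hf : ∀ x ∈ K, ContDiffAt ℝ 1 f x) : ∃ L, LipschitzOnWith L f K := by
  refine LocallyLipschitzOn.exists_lipschitzOnWith_of_compact hK fun x hx => ?_
  obtain ⟨L, t, ht, hL⟩ := (hf x hx).exists_lipschitzOnWith
  exact ⟨L, t, mem_nhdsWithin_of_mem_nhds ht, hL⟩

variable {m r : ℕ} {f : EuclideanSpace ℝ (Fin m) → EuclideanSpace ℝ (Fin m)}
  {U K : Set (EuclideanSpace ℝ (Fin m))} {t₀ T : ℝ} {y₀ : EuclideanSpace ℝ (Fin m)}
  {y : ℝ → EuclideanSpace ℝ (Fin m)}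

/-- This permits global existence and stability arguments; results return to `f` once the curves are
known to stay in `K`. -/
theorem exists_lipschitz_extension (hf : AnalyticOnNhd ℝ f U) (hK : IsCompact K) (hKU : K ⊆ U) :
    ∃ (g : EuclideanSpace ℝ (Fin m) → EuclideanSpace ℝ (Fin m)) (L : ℝ), 0 ≤ L ∧ Continuous g ∧
      (∀ x x', ‖g x - g x'‖ ≤ L * ‖x - x'‖) ∧ EqOn f g K := by
  obtain ⟨L, hL⟩ := exists_lipschitzOnWith_of_isCompact hK
    fun x hx => (hf x (hKU hx)).contDiffAt
  obtain ⟨g, hg, hfg⟩ := hL.extend_finite_dimension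
  exact ⟨g, _, NNReal.coe_nonneg _, hg.continuous, fun x x' => hg.norm_sub_le x x', hfg⟩

theorem IsSolution.continuousOn (hy : IsSolution f U t₀ T y₀ y) :
    ContinuousOn y (Icc t₀ (t₀ + T)) :=
  fun t ht => (hy.deriv t ht).continuousWithinAt

theorem IsSolution.contDiffOn (hf : AnalyticOnNhd ℝ f U) (hT : 0 < T)
    (hy : IsSolution f U t₀ T y₀ y) : ContDiffOn ℝ ∞ y (Icc t₀ (t₀ + T)) := by
  have hud := uniqueDiffOn_Icc (show t₀ < t₀ + T by linarith)
  rw [contDiffOn_infty]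
  intro n
  induction n with
  | zero => exact contDiffOn_zero.mpr hy.continuousOn
  | succ n ih =>
    push_cast
    rw [contDiffOn_succ_iff_derivWithin hud]
    refine ⟨fun t ht => (hy.deriv t ht).differentiableWithinAt, by simp, ?_⟩
    refine ContDiffOn.congr (f := f ∘ y) (fun t ht => ?_)
      fun t ht => (hy.deriv t ht).derivWithin (hud t ht)
    exact (hf _ (hy.mem t ht)).contDiffAt.comp_contDiffWithinAt t (ih t ht)

/-- The exact solution solves the truncated equation with defect `F(y) - P F(y) = O(h^r)`; apply
stability. -/
theorem exists_norm_sub_le_mul_pow {F : EuclideanSpace ℝ (Fin m) → EuclideanSpace ℝ (Fin m)}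
    (hT : 0 < T) (hFc : Continuous F) {L : ℝ} (hL : 0 ≤ L)
    (hF : ∀ x x', ‖F x - F x'‖ ≤ L * ‖x - x'‖)
    (hFy : ContDiffOn ℝ r (fun t => F (y t)) (Icc t₀ (t₀ + T)))
    (hy0 : y t₀ = y₀)
    (hy : ∀ t ∈ Icc t₀ (t₀ + T), HasDerivWithinAt y (F (y t)) (Icc t₀ (t₀ + T)) t) :
    ∃ C h₁ : ℝ, 0 ≤ C ∧ 0 < h₁ ∧ ∀ (N : ℕ) (h : ℝ), 0 < h → T = N * h → h ≤ h₁ → ∀ u,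
      IsTruncatedSolution F r t₀ h N y₀ u →
      ∀ t ∈ Icc t₀ (t₀ + T), ‖u t - y t‖ ≤ C * h ^ r := by
  obtain ⟨C₀, h₁, hC₀, hh₁, hstab⟩ := exists_stability_constant r L hL T hT.le
  obtain ⟨C₁, hC₁, hproj⟩ := exists_norm_sub_proj_le (show t₀ < t₀ + T by linarith) hFy
  refine ⟨C₀ * C₁, h₁, by positivity, hh₁, fun N h hh hNh hle u hω t ht => ?_⟩
  have hN : 0 < N := by
    rcases Nat.eq_zero_or_pos N with rfl | h0
    · rw [Nat.cast_zero, zero_mul] at hNh; exact absurd hNh hT.ne'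
    · exact h0
  have hgrid : grid t₀ h N = t₀ + T := by rw [grid, hNh]
  have hend : ∀ i < N, grid t₀ h i + h ≤ t₀ + T := fun i hi => by
    rw [← grid_succ, ← hgrid]; exact grid_mono hh.le hi
  rw [← hgrid] at ht
  rw [mul_assoc]
  refine hstab hFc hF (η := C₁ * h ^ r) (ρ := fun i c => F (y (grid t₀ h i + c * h)) -
    proj r (fun τ => F (y (grid t₀ h i + τ * h))) c) hh hle hNh.symm hN (by positivity) hω hy0
    (fun i hi c hc => ?_) (fun i hi c hc => ?_) t ht
  · rw [add_sub_cancel]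
    exact hasDerivWithinAt_comp_affine hh.le (le_grid hh.le i) (hend i hi)
      (hy _ (add_mul_mem_Icc hh.le (le_grid hh.le i) (hend i hi) hc))
  · exact hproj _ h hh.le (le_grid hh.le i) (hend i hi) c hc

/-- The derivative is Lipschitz on the compact thickening. The thickening need not be convex, so the
mean value inequality is applied on the ball of radius `‖x - z‖` about `z`. -/
theorem exists_norm_sub_sub_fderiv_le (hf : AnalyticOnNhd ℝ f U)
    {S : Set (EuclideanSpace ℝ (Fin m))} {δ : ℝ} (hSc : IsCompact S)
    (hSU : Metric.cthickening δ S ⊆ U) :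
    ∃ C : ℝ, 0 ≤ C ∧ ∀ z ∈ S, ∀ x, ‖x - z‖ ≤ δ →
      ‖f x - f z - fderiv ℝ f z (x - z)‖ ≤ C * ‖x - z‖ ^ 2 := by
  obtain ⟨C, hC⟩ := exists_lipschitzOnWith_of_isCompact (hSc.cthickening (r := δ))
    fun x hx => (hf.fderiv x (hSU hx)).contDiffAt
  refine ⟨C, C.2, fun z hz x hx => ?_⟩
  have hball : ∀ w ∈ Metric.closedBall z ‖x - z‖, w ∈ Metric.cthickening δ S := fun w hw =>
    Metric.mem_cthickening_of_dist_le w z δ S hz ((Metric.mem_closedBall.mp hw).trans hx)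
  have hzb : z ∈ Metric.closedBall z ‖x - z‖ := Metric.mem_closedBall_self (norm_nonneg _)
  have hxb : x ∈ Metric.closedBall z ‖x - z‖ := by rw [Metric.mem_closedBall, dist_eq_norm]
  have := (convex_closedBall z ‖x - z‖).norm_image_sub_le_of_norm_hasFDerivWithin_le'
    (f := f) (f' := fderiv ℝ f) (φ := fderiv ℝ f z) (C := C * ‖x - z‖)
    (fun w hw => (hf w (hSU (hball w hw))).differentiableAt.hasFDerivAt.hasFDerivWithinAt)
    (fun w hw => (hC.norm_sub_le (hball w hw) (hball z hzb)).trans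
      (mul_le_mul_of_nonneg_left (by rw [← dist_eq_norm]; exact hw) C.2)) hzb hxb
  calc _ ≤ C * ‖x - z‖ * ‖x - z‖ := this
    _ = _ := by ring

/-- A truncated solution that stays in a tube around the exact solution is of order `2 r` on the
grid. -/
theorem exists_superconvergence (hr : 1 ≤ r) (hU : IsOpen U) (hf : AnalyticOnNhd ℝ f U)
    (hT : 0 < T) (hy : IsSolution f U t₀ T y₀ y) :
    ∃ C δ h₁ : ℝ, 0 < δ ∧ 0 < h₁ ∧ ∀ (N : ℕ) (h : ℝ), 0 < h → T = N * h → h ≤ h₁ → ∀ u,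
      IsTruncatedSolution f r t₀ h N y₀ u → (∀ t ∈ Icc t₀ (t₀ + T), ‖u t - y t‖ ≤ δ) →
      ∀ i ≤ N, ‖u (grid t₀ h i) - y (grid t₀ h i)‖ ≤ C * h ^ (2 * r) := by
  have hab : t₀ < t₀ + T := by linarith
  set S := y '' Icc t₀ (t₀ + T) with hS
  have hSc : IsCompact S := isCompact_Icc.image_of_continuousOn hy.continuousOn
  have hyS : ∀ t ∈ Icc t₀ (t₀ + T), y t ∈ S := fun t ht => mem_image_of_mem y ht
  -- The tube depends only on `y` and `U`, which keeps the final constant independent of `K`.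
  obtain ⟨δ, hδ, hδU⟩ := hSc.exists_cthickening_subset_open hU
    (by rintro _ ⟨t, ht, rfl⟩; exact hy.mem t ht)
  set K₀ := Metric.cthickening δ S with hK₀
  obtain ⟨g, L, hL0, hgc, hg, hfg⟩ := exists_lipschitz_extension hf hSc.cthickening hδU
  have hSK : ∀ t ∈ Icc t₀ (t₀ + T), y t ∈ K₀ := fun t ht =>
    Metric.self_subset_cthickening S (hyS t ht)
  have hysm := hy.contDiffOn hf hT
  have hfy : ContDiffOn ℝ ∞ (fun t => g (y t)) (Icc t₀ (t₀ + T)) := by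
    refine ContDiffOn.congr (f := f ∘ y) (fun t ht => ?_) fun t ht => (hfg (hSK t ht)).symm
    exact (hf _ (hy.mem t ht)).contDiffAt.comp_contDiffWithinAt t (hysm t ht)
  have hA : ContDiffOn ℝ ∞ (fun t => fderiv ℝ f (y t)) (Icc t₀ (t₀ + T)) := fun t ht =>
    (hf.fderiv _ (hy.mem t ht)).contDiffAt.comp_contDiffWithinAt t (hysm t ht)
  have hgy : ContDiffOn ℝ r (fun t => g (y t)) (Icc t₀ (t₀ + T)) :=
    hfy.of_le (by exact_mod_cast le_top)
  have hyg : ∀ t ∈ Icc t₀ (t₀ + T), HasDerivWithinAt y (g (y t)) (Icc t₀ (t₀ + T)) t :=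
    fun t ht => (hy.deriv t ht).congr_deriv (hfg (hSK t ht))
  obtain ⟨D₁, h₁, hD₁, hh₁, hcoarse⟩ :=
    exists_norm_sub_le_mul_pow hT hgc hL0 hg hgy hy.init hyg
  obtain ⟨C₂, hC₂, hquad⟩ := exists_norm_sub_sub_fderiv_le hf hSc hδU
  obtain ⟨C₁, hC₁, hproj⟩ := exists_norm_sub_proj_le hab hgy
  obtain ⟨B, hB0, hB⟩ := exists_norm_proj_le r
  -- The summands bound, in turn, the error `ε`, the quadratic remainder `q` and the projection
  -- residual `R`.
  set D := D₁ + C₂ * D₁ ^ 2 + ((1 + B) * (L * D₁) + C₁) with hD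
  have hD0 : 0 ≤ D := by positivity
  obtain ⟨C₃, hC₃, hstep⟩ := exists_step_error_le hab hr hA hD0
  refine ⟨T * Real.exp (T * C₃) * C₃, δ, min h₁ 1, hδ, by positivity,
    fun N h hh hNh hle u hω hnear => ?_⟩
  have hh1 : h ≤ 1 := hle.trans (min_le_right _ _)
  have hgrid : grid t₀ h N = t₀ + T := by rw [grid, hNh]
  have hend : ∀ i < N, grid t₀ h i + h ≤ t₀ + T := fun i hi => by
    rw [← grid_succ, ← hgrid]; exact grid_mono hh.le hi
  have hωK : ∀ t ∈ Icc t₀ (t₀ + T), u t ∈ K₀ := fun t ht =>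
    Metric.mem_cthickening_of_dist_le _ _ δ S (hyS t ht) (by
      rw [dist_eq_norm]; exact hnear t ht)
  have hωg : IsTruncatedSolution g r t₀ h N y₀ u := hω.congr_field hh.le (by
    rw [hgrid]; exact fun t ht => hfg (hωK t ht))
  have herr := hcoarse N h hh hNh (hle.trans (min_le_left _ _)) u hωg
  have hωc := hω.continuousOn hh
  rw [hgrid] at hωc
  have hp : 0 ≤ h ^ r := by positivity
  have hlin : ∀ i < N, IsLinearizedError r (fun t => fderiv ℝ f (y t)) D (grid t₀ h i) h
      (fun c => u (grid t₀ h i + c * h) - y (grid t₀ h i + c * h))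
      (fun c => g (u (grid t₀ h i + c * h)) - g (y (grid t₀ h i + c * h)) -
        fderiv ℝ f (y (grid t₀ h i + c * h))
          (u (grid t₀ h i + c * h) - y (grid t₀ h i + c * h)))
      (fun c => g (u (grid t₀ h i + c * h)) -
        proj r (fun τ => g (u (grid t₀ h i + τ * h))) c) := by
    intro i hi
    have hs := le_grid (t₀ := t₀) hh.le i
    have hsb := hend i hi
    set s := grid t₀ h i
    have hmem : ∀ c ∈ Icc (0 : ℝ) 1, s + c * h ∈ Icc t₀ (t₀ + T) := fun c hc =>
      add_mul_mem_Icc hh.le hs hsb hc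
    have cω := continuousOn_comp_affine hh.le hs hsb hωc
    have cy := continuousOn_comp_affine hh.le hs hsb hy.continuousOn
    have cA := continuousOn_comp_affine hh.le hs hsb hA.continuousOn
    have cgω := hgc.comp_continuousOn cω
    have cgy := hgc.comp_continuousOn cy
    refine ⟨(cgω.sub cgy).sub (cA.clm_apply (cω.sub cy)),
      cgω.sub (continuous_proj r _).continuousOn, fun c hc => ?_, fun c hc => ?_, fun c hc => ?_,
      fun c hc => ?_, fun p hpd => integral_smul_sub_proj hpd cgω⟩
    · refine ((hωg.hasDerivWithinAt_step hh.le hi hc).sub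
        (hasDerivWithinAt_comp_affine hh.le hs hsb (hyg _ (hmem c hc)))).congr_deriv ?_
      rw [← smul_sub]
      congr 1
      abel
    · refine (herr _ (hmem c hc)).trans (mul_le_mul_of_nonneg_right ?_ hp)
      have : 0 ≤ C₂ * D₁ ^ 2 + ((1 + B) * (L * D₁) + C₁) := by positivity
      linarith
    · rw [← hfg (hωK _ (hmem c hc)), ← hfg (hSK _ (hmem c hc))]
      refine (hquad _ (hyS _ (hmem c hc)) _ (hnear _ (hmem c hc))).trans ?_
      calc C₂ * ‖u (s + c * h) - y (s + c * h)‖ ^ 2 ≤ C₂ * (D₁ * h ^ r) ^ 2 := by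
            gcongr; exact herr _ (hmem c hc)
        _ = C₂ * D₁ ^ 2 * h ^ (2 * r) := by ring
        _ ≤ D * h ^ (2 * r) := by
            refine mul_le_mul_of_nonneg_right ?_ (by positivity)
            have : 0 ≤ D₁ + ((1 + B) * (L * D₁) + C₁) := by positivity
            linarith
    · have hd : ∀ c ∈ Icc (0 : ℝ) 1,
          ‖g (u (s + c * h)) - g (y (s + c * h))‖ ≤ L * (D₁ * h ^ r) := fun c hc =>
        (hg _ _).trans (mul_le_mul_of_nonneg_left (herr _ (hmem c hc)) hL0)
      -- Comparing with `g(y)` avoids any bound on derivatives of `u`: the difference is `O(h^r)` by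
      -- the coarse estimate, and `g(y)` is smooth.
      have e : g (u (s + c * h)) - proj r (fun τ => g (u (s + τ * h))) c =
          (g (u (s + c * h)) - g (y (s + c * h))) -
            proj r (fun τ => g (u (s + τ * h)) - g (y (s + τ * h))) c +
          (g (y (s + c * h)) - proj r (fun τ => g (y (s + τ * h))) c) := by
        rw [proj_sub (φ := fun τ => g (u (s + τ * h))) (ψ := fun τ => g (y (s + τ * h))) cgω cgy]
        abel
      rw [e]
      refine (norm_add_le _ _).trans ((add_le_add_left (norm_sub_le _ _) _).trans ?_)
      have b1 := hd c hc
      have b2 := hB _ _ hd c hc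
      have b3 := hproj s h hh.le hs hsb c hc
      have : 0 ≤ (D₁ + C₂ * D₁ ^ 2) * h ^ r := by positivity
      calc _ ≤ L * (D₁ * h ^ r) + B * (L * (D₁ * h ^ r)) + C₁ * h ^ r := by gcongr
        _ = ((1 + B) * (L * D₁) + C₁) * h ^ r := by ring
        _ ≤ D * h ^ r := by
            rw [hD, add_mul (D₁ + C₂ * D₁ ^ 2)]
            linarith
  have hgr := discrete_gronwall (a := fun i => ‖u (grid t₀ h i) - y (grid t₀ h i)‖)
    (x := h * C₃) (d := h * (C₃ * h ^ (2 * r))) (N := N) (by positivity) (by positivity)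
    (by simp [grid_zero, hω.init, hy.init]) (fun i hi => by
      have := hstep _ h hh.le hh1 (le_grid hh.le i) (hend i hi) _ _ _ (hlin i hi)
      simpa [grid_succ] using this)
  intro i hi
  refine (hgr i hi).trans (le_of_eq ?_)
  rw [← mul_assoc (N : ℝ) h, ← hNh, hNh]
  ring

end Convergence

end TruncatedFourier

end

/-! ### The main theorem. -/

theorem corollary2p3 {m : ℕ} (r : ℕ) (hr : 1 ≤ r)
    (U : Set (EuclideanSpace ℝ (Fin m))) (hU : IsOpen U)
    (f : EuclideanSpace ℝ (Fin m) → EuclideanSpace ℝ (Fin m)) (hf : AnalyticOnNhd ℝ f U)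
    (t₀ T : ℝ) (hT : 0 < T) (y₀ : EuclideanSpace ℝ (Fin m))
    (y : ℝ → EuclideanSpace ℝ (Fin m)) (hy : TruncatedFourier.IsSolution f U t₀ T y₀ y) :
    ∃ C : ℝ, ∀ K : Set (EuclideanSpace ℝ (Fin m)), IsCompact K → K ⊆ U →
      (∀ t ∈ Set.Icc t₀ (t₀ + T), y t ∈ interior K) →
      ∃ h₀ : ℝ, 0 < h₀ ∧ ∀ (N : ℕ) (h : ℝ), 0 < h → T = N * h → h ≤ h₀ →
        ∃ ω : ℝ → EuclideanSpace ℝ (Fin m),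
          (TruncatedFourier.IsTruncatedSolution f r t₀ h N y₀ ω ∧
            ∀ t ∈ Set.Icc t₀ (t₀ + T), ω t ∈ K) ∧
          (∀ ω' : ℝ → EuclideanSpace ℝ (Fin m),
            TruncatedFourier.IsTruncatedSolution f r t₀ h N y₀ ω' →
            (∀ t ∈ Set.Icc t₀ (t₀ + T), ω' t ∈ K) →
            Set.EqOn ω' ω (Set.Icc t₀ (t₀ + T))) ∧
          TruncatedFourier.IsContinuousPiecewisePolynomial r t₀ h N ω ∧
          ∀ i ≤ N, ‖ω (TruncatedFourier.grid t₀ h i) - y (TruncatedFourier.grid t₀ h i)‖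
            ≤ C * h ^ (2 * r) := by
  obtain ⟨C, δ, h₁, hδ, hh₁, hsuper⟩ :=
    TruncatedFourier.exists_superconvergence hr hU hf hT hy
  refine ⟨C, fun K hK hKU hyK => ?_⟩
  have hyK' : ∀ t ∈ Set.Icc t₀ (t₀ + T), y t ∈ K := fun t ht => interior_subset (hyK t ht)
  obtain ⟨g, L, hL0, hgc, hg, hfg⟩ := TruncatedFourier.exists_lipschitz_extension hf hK hKU
  obtain ⟨δ', hδ', hthick⟩ := (isCompact_Icc.image_of_continuousOn
    hy.continuousOn).exists_cthickening_subset_open (isOpen_interior (s := K))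
    (by rintro _ ⟨t, ht, rfl⟩; exact hyK t ht)
  have hgy : ContDiffOn ℝ r (fun t => g (y t)) (Set.Icc t₀ (t₀ + T)) := by
    refine ContDiffOn.congr (f := f ∘ y) (fun t ht => ?_) fun t ht => (hfg (hyK' t ht)).symm
    exact (hf _ (hy.mem t ht)).contDiffAt.comp_contDiffWithinAt t
      ((hy.contDiffOn hf hT).of_le (by exact_mod_cast le_top) t ht)
  obtain ⟨D, h₂, hD, hh₂, hcoarse⟩ := TruncatedFourier.exists_norm_sub_le_mul_pow hT hgc hL0 hg hgy
    hy.init fun t ht => (hy.deriv t ht).congr_deriv (hfg (hyK' t ht))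
  obtain ⟨h₃, hh₃, hexists⟩ := TruncatedFourier.exists_isTruncatedSolution m r L hL0
  obtain ⟨C₀, h₄, -, hh₄, hstab⟩ := TruncatedFourier.exists_stability_constant r L hL0 T hT.le
  -- The last entry forces `D * h ^ r ≤ D * h ≤ min δ δ'`, so that `ω` lies both in the tube of the
  -- `2r` estimate and in `K`; `D + 1` guards against `D = 0`.
  refine ⟨min (min (min h₁ h₂) (min h₃ h₄)) (min 1 (min δ δ' / (D + 1))), by positivity,
    fun N h hh hNh hle => ?_⟩
  simp only [le_min_iff] at hle
  obtain ⟨⟨⟨hle1, hle2⟩, hle3, hle4⟩, hle5, hle6⟩ := hle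
  have hN : 0 < N := by
    rcases Nat.eq_zero_or_pos N with rfl | h0
    · rw [Nat.cast_zero, zero_mul] at hNh; exact absurd hNh hT.ne'
    · exact h0
  have hgrid : TruncatedFourier.grid t₀ h N = t₀ + T := by rw [TruncatedFourier.grid, hNh]
  obtain ⟨ω, hω⟩ := hexists hgc hg t₀ h y₀ N hh hle3
  have hnear : ∀ t ∈ Set.Icc t₀ (t₀ + T), ‖ω t - y t‖ ≤ min δ δ' := fun t ht => by
    refine (hcoarse N h hh hNh hle2 ω hω t ht).trans ?_
    rw [le_div_iff₀ (by positivity)] at hle6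
    have : h ^ r ≤ h := pow_le_of_le_one hh.le hle5 (by omega)
    nlinarith
  have hωK : ∀ t ∈ Set.Icc t₀ (t₀ + T), ω t ∈ K := fun t ht =>
    interior_subset (hthick (Metric.mem_cthickening_of_dist_le _ _ δ' _
      (Set.mem_image_of_mem y ht) (by
        rw [dist_eq_norm]; exact (hnear t ht).trans (min_le_right _ _))))
  have hωf : TruncatedFourier.IsTruncatedSolution f r t₀ h N y₀ ω := hω.congr_field hh.le (by
    rw [hgrid]; exact fun t ht => (hfg (hωK t ht)).symm)
  refine ⟨ω, ⟨hωf, hωK⟩, fun ω' hω' hωK' t ht => ?_, hωf.isContinuousPiecewisePolynomial hr hh,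
    hsuper N h hh hNh hle1 ω hωf fun t ht => (hnear t ht).trans (min_le_left _ _)⟩
  -- Values in `K` make any competitor a solution for `g` too, so stability with zero defect
  -- applies.
  have hω'g : TruncatedFourier.IsTruncatedSolution g r t₀ h N y₀ ω' := hω'.congr_field hh.le (by
    rw [hgrid]; exact fun t ht => hfg (hωK' t ht))
  have := hstab hgc hg (η := 0) (ρ := 0) hh hle4 hNh.symm hN le_rfl hω'g hω.init
    (fun i hi c hc => by simpa using hω.hasDerivWithinAt_step hh.le hi hc) (by simp) t
    (by rwa [hgrid])
  rwa [mul_zero, norm_le_zero_iff, sub_eq_zero] at this
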